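/- Let $\mathcal S$ be a finite vocabulary and $\mathcal D=\{(X_k,y_k)\}_{k=1}^n$ a dataset of sequences $X_k=[x_{k,1},\dots,x_{k,T}]\in\mathcal S^T$ with labels $y_k\in\{-1,1\}$, such that every $s\in\mathcal S$ appears in some sequence. For $s\in\mathcal S$ let $\alpha_s=\frac1{nT}\sum_{k=1}^n y_k\sum_{i=1}^T\mathbf 1_{x_{k,i}=s}$. A token $s$ is irrelevant if $\alpha_s=0$, completely positive (resp. completely negative) if it appears only in sequences with label $1$ (resp. $-1$); $\mathcal S_c$ denotes the set of all completely positive and all completely negative tokens. Assume that each sequence contains exactly one token of $\mathcal S$ that is completely positive or completely negative, that all its other tokens are irrelevant, and that at least one token of $\mathcal S$ is irrelevant (as is automatic if $T\ge 2$ and the completely positive/negative token occupies a single position of its sequence). Fix $v\in\mathbb R^d$ with $\|v\|_2=1$. For embeddings $\boldsymbol E=(E_s)_{s\in\mathcal S}$, $E_s\in\mathbb R^d$, and $p\in\mathbb R^d$ (the embedding of the $\langle\mathrm{cls}\rangle$ token), let $$f(X;p,\boldsymbol E)=\frac{\sum_{i=1}^T e^{p^\top E_{x_i}}E_{x_i}^\top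 v}{\sum_{j=1}^T e^{p^\top E_{x_j}}},\qquad \mathcal L(\boldsymbol E,p)=\frac1n\sum_{k=1}^n\log\bigl(1+e^{-y_kf(X_k;p,\boldsymbol E)}\bigr).$$ Let $E_s^0$ ($s\in\mathcal S$) and $p^0$ be i.i.d. $\mathcal N(0,\frac1d I)$, and perform one gradient step: $p^1=p^0-\eta_0\nabla_p\mathcal L(\boldsymbol E^0,p^0)$, $E^1_s=E^0_s-\eta_0\nabla_{E_s}\mathcal L(\boldsymbol E^0,p^0)$. Let $(p_t)_{t\ge0}$ be the solution of the gradient flow $\frac{\mathrm d}{\mathrm dt}p_t=-\nabla_p\mathcal L(\boldsymbol E^1,p_t)$ started at $p^1$. For a sequence $X$ and $p\in\mathbb R^d$ let $\mathcal S_X(p)$ be the set of tokens $s$ of $X$ that maximize $p^\top E^1_s$ over the tokens of $X$ (the tokens selected by $p$). For $p_\circ\in\mathbb R^d$ let $\hat p(p_\circ)$ be the vector of minimal Euclidean norm among all $p$ such that $\mathcal S_{X_k}(p)=\mathcal S_{X_k}(p_\circ)$ for all $k$ and $p^\top(E^1_s-E^1_{s'})\ge1$ for all $k$, all $s\in\mathcal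 S_{X_k}(p_\circ)$ and all tokens $s'$ of $X_k$ not in $\mathcal S_{X_k}(p_\circ)$; let $p_*(p_\circ)=\hat p(p_\circ)/\|\hat p(p_\circ)\|_2$ be the max-margin direction for the selection of $p_\circ$. Theorem. Let $\delta>0$ and $$\eta_0\ge4n^2T^2,\qquad d\ge\max\Bigl\{256,\ \bigl(2\log\tfrac{|\mathcal S|^2}{\delta}\bigr)^2,\ (88\eta_0^2+111\eta_0+2)^8,\ |\mathcal S|+3\Bigr\}.$$ Then, with probability at least $1-\delta$ over the initialization $(\boldsymbol E^0,p^0)$, $\|p_t\|_2\to\infty$ as $t\to\infty$ and, if the limit $p_\infty=\lim_{t\to\infty}p_t/\|p_t\|_2$ exists, then: 1. $p_\infty$ selects all completely positive and completely negative tokens, i.e. $\mathcal S_c\subseteq\bigcup_{k}\mathcal S_{X_k}(p_\infty)$; 2. $p_\infty$ is the max-margin direction for its own selection: the max-margin problem has a unique solution $\hat p(p_\infty)$ and $p_\infty=p_*(p_\infty)$. -/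

import Mathlib

open MeasureTheory ProbabilityTheory Filter Topology
open scoped RealInnerProductSpace Gradient

namespace ClsAttention

/-- The space of embedding vectors, `ℝ^d` with the Euclidean norm. -/
abbrev Emb (d : ℕ) : Type := EuclideanSpace ℝ (Fin d)

noncomputable section

/-! ### The dataset

A dataset over the vocabulary `S` is a family `X : Fin n → Fin T → S` of `n` sequences of `T` tokens,
with labels `y : Fin n → ℝ` in `{-1, 1}`. -/

section Data

variable {S : Type*} {n T : ℕ}

/-- The token `s` appears in the sequence `x`. -/
def Appears (x : Fin T → S) (s : S) : Prop := ∃ i, x i = s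

/-- The average signed frequency
`α_s = (1 / (n T)) ∑_{(X, y)} y ∑_i 1{x_i = s}`. -/
def signedFreq [DecidableEq S] (X : Fin n → Fin T → S) (y : Fin n → ℝ) (s : S) : ℝ :=
  1 / ((n : ℝ) * (T : ℝ)) * ∑ k, y k * ∑ i, if X k i = s then (1 : ℝ) else 0

/-- A token is irrelevant if its average signed frequency vanishes. -/
def Irrelevant [DecidableEq S] (X : Fin n → Fin T → S) (y : Fin n → ℝ) (s : S) : Prop :=
  signedFreq X y s = 0

/-- A token is completely positive if it appears only in sequences with label `1`. -/
def CompletelyPositive (X : Fin n → Fin T → S) (y : Fin n → ℝ) (s : S) : Prop :=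
  ∀ k, Appears (X k) s → y k = 1

/-- A token is completely negative if it appears only in sequences with label `-1`. -/
def CompletelyNegative (X : Fin n → Fin T → S) (y : Fin n → ℝ) (s : S) : Prop :=
  ∀ k, Appears (X k) s → y k = -1

/-- The set `S_c` of all completely positive and all completely negative tokens. -/
def completeTokens (X : Fin n → Fin T → S) (y : Fin n → ℝ) : Set S :=
  {s | CompletelyPositive X y s ∨ CompletelyNegative X y s}

/-- Each sequence contains a single completely positive or a single completely negative token, and
all the remaining tokens of the sequence are irrelevant. -/
def SingleCompleteToken [DecidableEq S] (X : Fin n → Fin T → S) (y : Fin n → ℝ) : Prop :=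
  ∀ k, ∃ s, Appears (X k) s ∧ (CompletelyPositive X y s ∨ CompletelyNegative X y s) ∧
    ∀ s', Appears (X k) s' → s' ≠ s → Irrelevant X y s'

end Data

/-! ### The model and the loss -/

section Model

variable {S : Type*} {n T d : ℕ}

/-- `[Softmax(a)]_i = exp(a_i) / ∑_j exp(a_j)`. -/
def softmax (a : Fin T → ℝ) (i : Fin T) : ℝ := Real.exp (a i) / ∑ j, Real.exp (a j)

/-- The one-layer attention model `f(X; p, E) = Softmax(pᵀ E_Xᵀ) E_X v`. -/
def attn (v : Emb d) (E : S → Emb d) (p : Emb d) (x : Fin T → S) : ℝ :=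
  ∑ i, softmax (fun j => ⟪p, E (x j)⟫) i * ⟪E (x i), v⟫

/-- The empirical logistic loss. -/
def loss (X : Fin n → Fin T → S) (y : Fin n → ℝ) (v : Emb d) (E : S → Emb d) (p : Emb d) : ℝ :=
  1 / (n : ℝ) * ∑ k, Real.log (1 + Real.exp (-(y k * attn v E p (X k))))

/-- The gradient `∇_p L(E, p)`. -/
def gradCls (X : Fin n → Fin T → S) (y : Fin n → ℝ) (v : Emb d) (E : S → Emb d) (p : Emb d) :
    Emb d :=
  ∇ (fun p' => loss X y v E p') p

/-- The gradient `∇_{E_s} L(E, p)` with respect to the embedding of the token `s`. -/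
def gradTok [DecidableEq S] (X : Fin n → Fin T → S) (y : Fin n → ℝ) (v : Emb d) (E : S → Emb d)
    (p : Emb d) (s : S) : Emb d :=
  ∇ (fun e => loss X y v (Function.update E s e) p) (E s)

/-- The context embeddings `E¹` after one gradient step of size `η` from `(E⁰, p⁰)`. -/
def stepTok [DecidableEq S] (X : Fin n → Fin T → S) (y : Fin n → ℝ) (v : Emb d) (η : ℝ)
    (E0 : S → Emb d) (p0 : Emb d) (s : S) : Emb d :=
  E0 s - η • gradTok X y v E0 p0 s

/-- The embedding `p¹` of the `⟨cls⟩` token after one gradient step of size `η` from `(E⁰, p⁰)`. -/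
def stepCls (X : Fin n → Fin T → S) (y : Fin n → ℝ) (v : Emb d) (η : ℝ)
    (E0 : S → Emb d) (p0 : Emb d) : Emb d :=
  p0 - η • gradCls X y v E0 p0

/-- `p : ℝ → ℝ^d`, considered on `[0, ∞)`, solves the gradient flow
`dp_t/dt = -∇_p L(E, p_t)` with `p_0 = pinit`. -/
def IsGradientFlow (X : Fin n → Fin T → S) (y : Fin n → ℝ) (v : Emb d) (E : S → Emb d)
    (pinit : Emb d) (p : ℝ → Emb d) : Prop :=
  p 0 = pinit ∧
    ∀ t, 0 ≤ t → HasDerivWithinAt p (-gradCls X y v E (p t)) (Set.Ici 0) t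

/-- The law of the initialization `(E⁰, p⁰)`: the vectors `E⁰_s`, `s ∈ S`, and `p⁰` are independent,
each with law `N(0, (1/d) I)`. -/
def initLaw (S : Type*) [Fintype S] (d : ℕ) : Measure ((S → Emb d) × Emb d) :=
  (Measure.pi fun _ : S => multivariateGaussian 0 ((1 / (d : ℝ)) • (1 : Matrix _ _ ℝ))).prod
    (multivariateGaussian 0 ((1 / (d : ℝ)) • (1 : Matrix _ _ ℝ)))

end Model

/-! ### Max-margin token selection -/

section Selection

variable {S : Type*} {n T d : ℕ}

/-- The set `S_x(p)` of the tokens of the sequence `x` selected by `p`, that is, those which maximize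
`pᵀ E_s` over the tokens `s` of `x`. -/
def selected (E : S → Emb d) (x : Fin T → S) (p : Emb d) : Set S :=
  {s | Appears x s ∧ ∀ s', Appears x s' → ⟪p, E s'⟫ ≤ ⟪p, E s⟫}

/-- `p` and `p'` select the same tokens in every sequence. -/
def SameSelection (E : S → Emb d) (X : Fin n → Fin T → S) (p p' : Emb d) : Prop :=
  ∀ k, selected E (X k) p = selected E (X k) p'

/-- The feasible points of the max-margin problem of `q`: the vectors equivalent to `q` which separate
with margin at least `1`, in every sequence, the selected tokens from the other ones. -/
def marginFeasible (E : S → Emb d) (X : Fin n → Fin T → S) (q : Emb d) : Set (Emb d) :=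
  {p | SameSelection E X p q ∧
    ∀ k, ∀ s ∈ selected E (X k) q, ∀ s', Appears (X k) s' → s' ∉ selected E (X k) q →
      1 ≤ ⟪p, E s - E s'⟫}

/-- The set `P_*(q)` of the max-margin directions for the selection of `q`: the normalized
minimum-norm feasible points. -/
def maxMarginDirections (E : S → Emb d) (X : Fin n → Fin T → S) (q : Emb d) : Set (Emb d) :=
  {u | ∃ phat ∈ marginFeasible E X q,
    (∀ p ∈ marginFeasible E X q, ‖phat‖ ≤ ‖p‖) ∧ u = (‖phat‖)⁻¹ • phat}

end Selection

end

end ClsAttention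

open ClsAttention

namespace ClsAttention

/-! ### Calculus of the softmax average and of the logistic loss -/

section Calculus

variable {T n : ℕ}

/-! On an event of probability at least `1 - δ`, the initial embeddings, `p⁰` and `v` are orthogonal
up to `τ = 3 d^{-1/4}` and the random vectors have squared norm of order one (`NearOrthogonal`,
`initLaw_compl_nearOrthogonal_le`). Everything after that is deterministic.

At such an initialization the attention is nearly uniform and the logistic weights are nearly `1/2`,
so one step gives `⟪E¹_s, v⟫ ≈ (η/2) α_s`. This is almost zero for irrelevant tokens and large, with
the sign of the label, for completely positive or negative ones. The scores `⟪p¹, E¹_s⟫` remain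
small, so the loss after the step is so low that every sequence has margin at least `1/2`. The loss
decreases along the flow, hence this confidence persists for all time (`le_label_mul_attn_step`,
`loss_le`, `confident_of_loss_le`).

Let `c k` be the complete token of sequence `k`. The velocity of the flow is a combination of the
differences `E (c k) - E (X k i)` (`inner_neg_gradCls`). Under confidence its coefficients, the
pulls, are positive for `X k i ≠ c k` and comparable to `exp (-⟪p, E (c k) - E (X k i)⟫)`
(`exists_pull_bounds`).

Divergence: some `w` separates complete tokens from the others. The speed is at most a constant
times the growth rate of `⟪w, p⟫`, so a bounded `⟪w, p⟫` would keep `p` in a ball, where that rate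
is bounded below: a contradiction (`tendsto_norm_atTop`).

Limit direction: confidence prevents any token from beating `c k` by more than a fixed score, so `c
k` is selected in the limit. For optimality of the margin, let `m` be the smallest margin of `p_∞`
and `q` any feasible point. Tokens of larger margin have exponentially smaller pull, so eventually
the velocity has nonnegative inner product with `(m + ε) q - p_∞`; passing to the limit direction
and letting `ε → 0` gives `m ⟪q, p_∞⟫ ≥ 1` (`one_le_margin_mul_inner`). Since `p_∞ / m` is itself
feasible, it is the unique minimum-norm point. -/

lemma softmax_nonneg (a : Fin T → ℝ) (i : Fin T) : 0 ≤ softmax a i := by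
  unfold softmax; positivity

lemma sum_exp_pos (a : Fin T → ℝ) (i : Fin T) : 0 < ∑ j, Real.exp (a j) :=
  Finset.sum_pos (fun _ _ => Real.exp_pos _) ⟨i, Finset.mem_univ i⟩

lemma softmax_pos (a : Fin T → ℝ) (i : Fin T) : 0 < softmax a i :=
  div_pos (Real.exp_pos _) (sum_exp_pos a i)

lemma sum_softmax (a : Fin T → ℝ) (i : Fin T) : ∑ j, softmax a j = 1 := by
  unfold softmax
  rw [← Finset.sum_div, div_self (sum_exp_pos a i).ne']

lemma sum_softmax_le_one (a : Fin T → ℝ) : ∑ j, softmax a j ≤ 1 := by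
  by_cases h : Nonempty (Fin T)
  · exact (sum_softmax a h.some).le
  · have : IsEmpty (Fin T) := not_nonempty_iff.1 h
    simp

/-- Minus the derivative of `z ↦ log (1 + exp (-z))`. -/
noncomputable def logisticWeight (z : ℝ) : ℝ := 1 / (1 + Real.exp z)

lemma logisticWeight_pos (z : ℝ) : 0 < logisticWeight z := by
  unfold logisticWeight; positivity

lemma logisticWeight_le_one (z : ℝ) : logisticWeight z ≤ 1 := by
  unfold logisticWeight
  rw [div_le_one (by positivity)]
  linarith [Real.exp_pos z]

variable {V : Type*} [NormedAddCommGroup V] [NormedSpace ℝ V]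

lemma hasFDerivAt_softmax {a : Fin T → V → ℝ} {A : Fin T → V →L[ℝ] ℝ} {x : V}
    (ha : ∀ i, HasFDerivAt (a i) (A i) x) (i : Fin T) :
    HasFDerivAt (fun z => softmax (fun j => a j z) i)
      (softmax (fun j => a j x) i • (A i - ∑ j, softmax (fun j => a j x) j • A j)) x := by
  have hexp : ∀ j, HasFDerivAt (fun z => Real.exp (a j z)) (Real.exp (a j x) • A j) x :=
    fun j => (ha j).exp
  have hsum : HasFDerivAt (fun z => ∑ j, Real.exp (a j z)) (∑ j, Real.exp (a j x) • A j) x :=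
    HasFDerivAt.fun_sum fun j _ => hexp j
  have hZ := (sum_exp_pos (fun j => a j x) i).ne'
  have hinv := (hasDerivAt_inv hZ).comp_hasFDerivAt x hsum
  refine ((hexp i).mul hinv).congr_fderiv ?_
  ext q
  simp only [softmax, smul_apply, sub_apply, add_apply, Function.comp_apply,
    sum_apply, smul_eq_mul, div_mul_eq_mul_div, ← Finset.sum_div]
  field_simp
  ring

/-- The covariance form of the derivative: moving the scores changes the average through the
deviations of `b` from its mean. Scores and values both vary here, so the formula serves for the
gradient in `p` and for the gradient in a token embedding. -/
lemma hasFDerivAt_softmax_average {a b : Fin T → V → ℝ} {A B : Fin T → V →L[ℝ] ℝ} {x : V}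
    (ha : ∀ i, HasFDerivAt (a i) (A i) x) (hb : ∀ i, HasFDerivAt (b i) (B i) x) :
    HasFDerivAt (fun z => ∑ i, softmax (fun j => a j z) i * b i z)
      (∑ i, softmax (fun j => a j x) i •
        (B i + (b i x - ∑ j, softmax (fun j => a j x) j * b j x) • A i)) x := by
  refine (HasFDerivAt.fun_sum fun i _ => (hasFDerivAt_softmax ha i).mul (hb i)).congr_fderiv ?_
  ext q
  simp only [smul_apply, sub_apply,
    add_apply, sum_apply, smul_eq_mul]
  set σ := softmax (fun j => a j x)
  have h : ∀ i, σ i * (B i q) + b i x * (σ i * (A i q - ∑ j, σ j * A j q)) =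
      σ i * (B i q + b i x * A i q) - (σ i * b i x) * ∑ j, σ j * A j q := fun i => by ring
  have h' : ∀ i, σ i * (B i q + (b i x - ∑ j, σ j * b j x) * A i q) =
      σ i * (B i q + b i x * A i q) - (∑ j, σ j * b j x) * (σ i * A i q) := fun i => by ring
  rw [Finset.sum_congr rfl fun i _ => h i, Finset.sum_congr rfl fun i _ => h' i,
    Finset.sum_sub_distrib, Finset.sum_sub_distrib, ← Finset.sum_mul, ← Finset.mul_sum]

lemma hasFDerivAt_logistic_average {y : Fin n → ℝ} {F : Fin n → V → ℝ}
    {F' : Fin n → V →L[ℝ] ℝ} {x : V} (hF : ∀ k, HasFDerivAt (F k) (F' k) x) :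
    HasFDerivAt (fun z => 1 / (n : ℝ) * ∑ k, Real.log (1 + Real.exp (-(y k * F k z))))
      (-(1 / (n : ℝ)) • ∑ k, (y k * logisticWeight (y k * F k x)) • F' k) x := by
  have hk : ∀ k, HasFDerivAt (fun z => Real.log (1 + Real.exp (-(y k * F k z))))
      (-(y k * logisticWeight (y k * F k x)) • F' k) x := fun k => by
    have h1 := (((hF k).const_mul (y k)).fun_neg.exp.const_add 1).log
      (by positivity : (1 + Real.exp (-(y k * F k x))) ≠ 0)
    refine h1.congr_fderiv ?_
    ext q
    simp only [smul_apply, neg_apply, smul_eq_mul,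
      logisticWeight, Real.exp_neg]
    have := Real.exp_pos (y k * F k x)
    field_simp
    ring
  refine ((HasFDerivAt.fun_sum fun k _ => hk k).const_mul (1 / (n : ℝ))).congr_fderiv ?_
  ext q
  simp [Finset.mul_sum]

end Calculus

/-! ### Gradients of the loss in the `⟨cls⟩` embedding and in the token embeddings -/

section Gradients

variable {S : Type*} {n T d : ℕ}

/-- The attention paid by `p` to the `i`-th token of the sequence `x`. -/
noncomputable abbrev attnWeight (E : S → Emb d) (p : Emb d) (x : Fin T → S) : Fin T → ℝ :=
  softmax fun j => ⟪p, E (x j)⟫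

lemma hasFDerivAt_attn_cls (v : Emb d) (E : S → Emb d) (p : Emb d) (x : Fin T → S) :
    HasFDerivAt (fun p' => attn v E p' x)
      (∑ i, attnWeight E p x i • ((⟪E (x i), v⟫ - attn v E p x) • innerSL ℝ (E (x i)))) p := by
  have h := hasFDerivAt_softmax_average (a := fun i p' => ⟪p', E (x i)⟫)
    (b := fun i (_ : Emb d) => ⟪E (x i), v⟫) (A := fun i => innerSL ℝ (E (x i)))
    (B := fun _ => 0) (x := p) (fun i => by
      have := (innerSL ℝ (E (x i))).hasFDerivAt (x := p)
      simpa [real_inner_comm] using this) (fun i => hasFDerivAt_const _ _)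
  exact h.congr_fderiv (by simp only [zero_add]; rfl)

lemma hasFDerivAt_loss_cls (X : Fin n → Fin T → S) (y : Fin n → ℝ) (v : Emb d) (E : S → Emb d)
    (p : Emb d) :
    HasFDerivAt (fun p' => loss X y v E p')
      (-(1 / (n : ℝ)) • ∑ k, (y k * logisticWeight (y k * attn v E p (X k))) •
        ∑ i, attnWeight E p (X k) i •
          ((⟪E (X k i), v⟫ - attn v E p (X k)) • innerSL ℝ (E (X k i)))) p :=
  hasFDerivAt_logistic_average fun k => hasFDerivAt_attn_cls v E p (X k)

lemma inner_gradCls (X : Fin n → Fin T → S) (y : Fin n → ℝ) (v : Emb d) (E : S → Emb d)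
    (p q : Emb d) :
    ⟪gradCls X y v E p, q⟫ =
      -(1 / (n : ℝ) * ∑ k, y k * logisticWeight (y k * attn v E p (X k)) *
        ∑ i, attnWeight E p (X k) i *
          ((⟪E (X k i), v⟫ - attn v E p (X k)) * ⟪E (X k i), q⟫)) := by
  unfold gradCls
  rw [inner_gradient_left, (hasFDerivAt_loss_cls X y v E p).fderiv]
  simp

lemma hasFDerivAt_attn_tok [DecidableEq S] (v : Emb d) (E : S → Emb d) (p : Emb d) (s : S)
    (x : Fin T → S) :
    HasFDerivAt (fun e => attn v (Function.update E s e) p x)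
      (∑ i, attnWeight E p x i • ((if x i = s then innerSL ℝ v else 0) +
        (⟪E (x i), v⟫ - attn v E p x) • (if x i = s then innerSL ℝ p else 0))) (E s) := by
  have h := hasFDerivAt_softmax_average
    (a := fun i e => ⟪p, Function.update E s e (x i)⟫)
    (b := fun i e => ⟪Function.update E s e (x i), v⟫)
    (A := fun i => if x i = s then innerSL ℝ p else 0)
    (B := fun i => if x i = s then innerSL ℝ v else 0) (x := E s) (fun i => by
      by_cases hi : x i = s
      · simp only [hi, Function.update_self, if_true]
        exact (innerSL ℝ p).hasFDerivAt
      · simp only [hi, Function.update_of_ne, if_false, ne_eq, not_false_eq_true]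
        exact hasFDerivAt_const _ _) (fun i => by
      by_cases hi : x i = s
      · simp only [hi, Function.update_self, if_true]
        simpa [real_inner_comm] using (innerSL ℝ v).hasFDerivAt (x := E s)
      · simp only [hi, Function.update_of_ne, if_false, ne_eq, not_false_eq_true]
        exact hasFDerivAt_const _ _)
  simp only [Function.update_eq_self] at h
  exact h

lemma inner_gradTok [DecidableEq S] (X : Fin n → Fin T → S) (y : Fin n → ℝ) (v : Emb d)
    (E : S → Emb d) (p : Emb d) (s : S) (q : Emb d) :
    ⟪gradTok X y v E p s, q⟫ =
      -(1 / (n : ℝ) * ∑ k, y k * logisticWeight (y k * attn v E p (X k)) *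
        ∑ i, if X k i = s then attnWeight E p (X k) i *
          (⟪v, q⟫ + (⟪E s, v⟫ - attn v E p (X k)) * ⟪p, q⟫) else 0) := by
  unfold gradTok
  have h := hasFDerivAt_logistic_average (y := y)
    fun k => hasFDerivAt_attn_tok v E p s (X k)
  rw [inner_gradient_left]
  unfold loss
  rw [h.fderiv]
  simp only [Function.update_eq_self, smul_apply,
    sum_apply, add_apply, smul_eq_mul, neg_mul]
  congr 3
  ext k
  congr 2
  ext i
  split_ifs with hi
  · simp [hi]
  · simp

/-- The displacement of a token embedding in the first gradient step along `v`. -/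
noncomputable def stepCoeffDir [DecidableEq S] (X : Fin n → Fin T → S) (y : Fin n → ℝ) (v : Emb d)
    (E : S → Emb d) (p : Emb d) (s : S) : ℝ :=
  1 / (n : ℝ) * ∑ k, y k * logisticWeight (y k * attn v E p (X k)) *
    ∑ i, if X k i = s then attnWeight E p (X k) i else 0

/-- The displacement of a token embedding in the first gradient step along the embedding `p`. -/
noncomputable def stepCoeffCls [DecidableEq S] (X : Fin n → Fin T → S) (y : Fin n → ℝ) (v : Emb d)
    (E : S → Emb d) (p : Emb d) (s : S) : ℝ :=
  1 / (n : ℝ) * ∑ k, y k * logisticWeight (y k * attn v E p (X k)) *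
    ∑ i, if X k i = s then attnWeight E p (X k) i * (⟪E s, v⟫ - attn v E p (X k)) else 0

/-- The loss depends on `E s` only through its value `⟪E s, v⟫` and its score `⟪p, E s⟫`, so the
gradient lies in the span of `v` and `p`. -/
lemma stepTok_eq [DecidableEq S] (X : Fin n → Fin T → S) (y : Fin n → ℝ) (v : Emb d) (η : ℝ)
    (E : S → Emb d) (p : Emb d) (s : S) :
    stepTok X y v η E p s =
      E s + η • (stepCoeffDir X y v E p s • v + stepCoeffCls X y v E p s • p) := by
  refine ext_inner_right ℝ fun q => ?_
  have key : -⟪gradTok X y v E p s, q⟫ =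
      stepCoeffDir X y v E p s * ⟪v, q⟫ + stepCoeffCls X y v E p s * ⟪p, q⟫ := by
    rw [inner_gradTok, neg_neg, stepCoeffDir, stepCoeffCls, mul_assoc, mul_assoc, ← mul_add,
      Finset.sum_mul, Finset.sum_mul, ← Finset.sum_add_distrib]
    congr 1
    refine Finset.sum_congr rfl fun k _ => ?_
    rw [mul_assoc _ (∑ i, _) ⟪v, q⟫, mul_assoc _ (∑ i, _) ⟪p, q⟫, ← mul_add, Finset.sum_mul,
      Finset.sum_mul, ← Finset.sum_add_distrib]
    congr 1
    refine Finset.sum_congr rfl fun i _ => ?_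
    split_ifs
    · ring
    · ring
  rw [stepTok, inner_sub_left, inner_add_left, real_inner_smul_left, real_inner_smul_left,
    inner_add_left, real_inner_smul_left, real_inner_smul_left, ← key]
  ring

end Gradients

/-! ### The loss landscape in the embedding of the `⟨cls⟩` token -/

section Landscape

variable {S : Type*} {n T d : ℕ}

/-- Every sequence is classified correctly with margin at least `1/2`. -/
def Confident (X : Fin n → Fin T → S) (y : Fin n → ℝ) (v : Emb d) (E : S → Emb d) (p : Emb d) :
    Prop :=
  ∀ k, 1 / 2 ≤ y k * attn v E p (X k)

/-- The rate at which the gradient flow separates the `i`-th token of the `k`-th sequence from a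
reference token. -/
noncomputable def pull (X : Fin n → Fin T → S) (y : Fin n → ℝ) (v : Emb d) (E : S → Emb d)
    (p : Emb d) (k : Fin n) (i : Fin T) : ℝ :=
  logisticWeight (y k * attn v E p (X k)) * attnWeight E p (X k) i *
    (y k * (attn v E p (X k) - ⟪E (X k i), v⟫))

variable {X : Fin n → Fin T → S} {y : Fin n → ℝ} {v : Emb d} {E : S → Emb d} {c : Fin n → S}

/-- The deviations of the values from their softmax average have weighted sum zero, so any reference
vector `E (c k)` may be subtracted in each sequence. This turns the velocity into a sum over token
differences. -/
lemma inner_neg_gradCls (c : Fin n → S) (p q : Emb d) :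
    ⟪-gradCls X y v E p, q⟫ =
      1 / (n : ℝ) * ∑ k, ∑ i, pull X y v E p k i * ⟪q, E (c k) - E (X k i)⟫ := by
  rw [inner_neg_left, inner_gradCls, neg_neg]
  congr 1
  refine Finset.sum_congr rfl fun k _ => ?_
  have h0 : ∑ i, attnWeight E p (X k) i * (attn v E p (X k) - ⟪E (X k i), v⟫) = 0 := by
    rcases isEmpty_or_nonempty (Fin T) with hT | ⟨⟨i⟩⟩
    · simp
    · simp_rw [mul_sub, Finset.sum_sub_distrib, ← Finset.sum_mul]
      rw [sum_softmax _ i, one_mul]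
      exact sub_self _
  have h1 : ∀ i, pull X y v E p k i * ⟪q, E (c k) - E (X k i)⟫ =
      y k * logisticWeight (y k * attn v E p (X k)) * (attnWeight E p (X k) i *
          ((⟪E (X k i), v⟫ - attn v E p (X k)) * ⟪E (X k i), q⟫)) +
        y k * logisticWeight (y k * attn v E p (X k)) * ⟪q, E (c k)⟫ *
        (attnWeight E p (X k) i * (attn v E p (X k) - ⟪E (X k i), v⟫)) := fun i => by
    rw [pull, inner_sub_right, real_inner_comm q (E (X k i))]
    ring
  rw [Finset.sum_congr rfl fun i _ => h1 i, Finset.sum_add_distrib, ← Finset.mul_sum,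
    ← Finset.mul_sum, h0, mul_zero, add_zero]

/-- All terms of the loss are nonnegative, so a bound on their sum bounds each one. The form is
chosen so that confidence is inherited by every point of smaller loss. -/
lemma confident_of_loss_le {p : Emb d} (hn : 0 < n)
    (h : n * loss X y v E p ≤ Real.log (1 + Real.exp (-(1 / 2)))) : Confident X y v E p := by
  intro k
  have hn' : (n : ℝ) ≠ 0 := by positivity
  rw [loss, ← mul_assoc, mul_one_div_cancel hn', one_mul] at h
  have hk := (Finset.single_le_sum (f := fun k => Real.log (1 + Real.exp (-(y k * attn v E p (X k)))))
    (fun k _ => Real.log_nonneg (by linarith [Real.exp_pos (-(y k * attn v E p (X k)))]))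
    (Finset.mem_univ k)).trans h
  have h2 := (Real.log_le_log_iff (by positivity) (by positivity)).1 hk
  have h3 := Real.exp_le_exp.1 (by linarith : Real.exp (-(y k * attn v E p (X k))) ≤
    Real.exp (-(1 / 2)))
  linarith

lemma pull_pos (hirr : ∀ k i, X k i ≠ c k → y k * ⟪E (X k i), v⟫ ≤ 1 / 4) {p : Emb d}
    (hp : Confident X y v E p) {k : Fin n} {i : Fin T} (hi : X k i ≠ c k) :
    0 < pull X y v E p k i := by
  have h1 := hp k
  have h2 := hirr k i hi
  exact mul_pos (mul_pos (logisticWeight_pos _) (softmax_pos _ _)) (by rw [mul_sub]; linarith)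

lemma exists_abs_inner_le [Finite S] (E : S → Emb d) (v : Emb d) :
    ∃ M : ℝ, 1 ≤ M ∧ ∀ s, |⟪E s, v⟫| ≤ M := by
  obtain ⟨M, hM⟩ := (Set.finite_range fun s => |⟪E s, v⟫|).bddAbove
  exact ⟨max M 1, le_max_right _ _, fun s => (hM ⟨s, rfl⟩).trans (le_max_left _ _)⟩

lemma exists_norm_le [Finite S] (E : S → Emb d) : ∃ M : ℝ, 0 < M ∧ ∀ s, ‖E s‖ ≤ M := by
  obtain ⟨M, hM⟩ := (Set.finite_range fun s => ‖E s‖).bddAbove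
  exact ⟨max M 1, by positivity, fun s => (hM ⟨s, rfl⟩).trans (le_max_left _ _)⟩

lemma abs_attn_le {M : ℝ} (hM0 : 0 ≤ M) (hM : ∀ s, |⟪E s, v⟫| ≤ M) (p : Emb d) (x : Fin T → S) :
    |attn v E p x| ≤ M := by
  refine (Finset.abs_sum_le_sum_abs _ _).trans ?_
  calc ∑ i, |softmax (fun j => ⟪p, E (x j)⟫) i * ⟪E (x i), v⟫|
      ≤ ∑ i, softmax (fun j => ⟪p, E (x j)⟫) i * M := Finset.sum_le_sum fun i _ => by
        rw [abs_mul, abs_of_nonneg (softmax_nonneg _ _)]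
        exact mul_le_mul_of_nonneg_left (hM _) (softmax_nonneg _ _)
    _ ≤ M := by
        rw [← Finset.sum_mul]
        exact mul_le_of_le_one_left hM0 (sum_softmax_le_one _)

/-- Tokens other than `c k` contribute at most `1/4` to the signed output, so an output of at least
`1/2` forces a fixed share of the softmax mass onto `c k`; no other token can dominate it by more
than a constant factor. -/
lemma exists_exp_inner_le [Finite S] (hy : ∀ k, y k = 1 ∨ y k = -1)
    (hirr : ∀ k i, X k i ≠ c k → y k * ⟪E (X k i), v⟫ ≤ 1 / 4) :
    ∃ K : ℝ, 0 < K ∧ ∀ p, Confident X y v E p → ∀ k i,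
      Real.exp ⟪p, E (X k i)⟫ ≤ K * Real.exp ⟪p, E (c k)⟫ := by
  obtain ⟨M, hM1, hM⟩ := exists_abs_inner_le E v
  refine ⟨4 * M * (T + 1), by positivity, fun p hp k i => ?_⟩
  set Z := ∑ j, Real.exp ⟪p, E (X k j)⟫ with hZ
  have hZpos : 0 < Z := sum_exp_pos (fun j => ⟪p, E (X k j)⟫) i
  have hiZ : Real.exp ⟪p, E (X k i)⟫ ≤ Z :=
    Finset.single_le_sum (f := fun j => Real.exp ⟪p, E (X k j)⟫)
      (fun j _ => (Real.exp_pos _).le) (Finset.mem_univ i)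
  have h1 : y k * attn v E p (X k) ≤ ∑ j, (attnWeight E p (X k) j * (1 / 4) +
      M * (Real.exp ⟪p, E (c k)⟫ / Z)) := by
    rw [attn, Finset.mul_sum]
    refine Finset.sum_le_sum fun j _ => ?_
    by_cases hj : X k j = c k
    · have hw : attnWeight E p (X k) j = Real.exp ⟪p, E (c k)⟫ / Z := by
        rw [← hj, hZ]
        rfl
      have hle : y k * ⟪E (X k j), v⟫ ≤ M := by
        refine (le_abs_self _).trans ?_
        rcases hy k with h | h <;> simp [h, hM]
      have hpos := softmax_nonneg (fun j => ⟪p, E (X k j)⟫) j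
      rw [← hw]
      nlinarith [mul_le_mul_of_nonneg_left hle hpos]
    · have hpos := softmax_nonneg (fun j => ⟪p, E (X k j)⟫) j
      have : 0 ≤ M * (Real.exp ⟪p, E (c k)⟫ / Z) := by positivity
      nlinarith [mul_le_mul_of_nonneg_left (hirr k j hj) hpos]
  rw [Finset.sum_add_distrib, ← Finset.sum_mul, sum_softmax _ i, Finset.sum_const,
    Finset.card_univ, Fintype.card_fin, nsmul_eq_mul] at h1
  have h2 := hp k
  have h3 : 1 / 4 ≤ T * (M * (Real.exp ⟪p, E (c k)⟫ / Z)) := by linarith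
  have h4 : Z ≤ 4 * M * T * Real.exp ⟪p, E (c k)⟫ := by
    rw [← mul_div_assoc, ← mul_div_assoc, le_div_iff₀ hZpos] at h3
    linarith
  have h5 : 0 ≤ M * Real.exp ⟪p, E (c k)⟫ := by positivity
  nlinarith

/-- All factors of the pull except the attention ratio stay within constants: the logistic weight is
at least `1 / (1 + exp M)` and at most `1`, the value gap lies between `1/4` and `2 * M`, and by
`exists_exp_inner_le` the softmax denominator is comparable to `exp ⟪p, E (c k)⟫`. -/
lemma exists_pull_bounds [Finite S] (hy : ∀ k, y k = 1 ∨ y k = -1)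
    (hc : ∀ k, Appears (X k) (c k))
    (hirr : ∀ k i, X k i ≠ c k → y k * ⟪E (X k i), v⟫ ≤ 1 / 4) :
    ∃ A B : ℝ, 0 < A ∧ 0 < B ∧ ∀ p, Confident X y v E p → ∀ k i, X k i ≠ c k →
      A * Real.exp (-⟪p, E (c k) - E (X k i)⟫) ≤ pull X y v E p k i ∧
      pull X y v E p k i ≤ B * Real.exp (-⟪p, E (c k) - E (X k i)⟫) := by
  obtain ⟨M, hM1, hM⟩ := exists_abs_inner_le E v
  obtain ⟨K, hK, hKp⟩ := exists_exp_inner_le hy hirr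
  refine ⟨1 / (1 + Real.exp M) * (1 / ((T + 1) * K)) * (1 / 4), 2 * M, by positivity,
    by positivity, fun p hp k i hi => ?_⟩
  have hM0 : 0 ≤ M := by linarith
  have hyabs : |y k| = 1 := by rcases hy k with h | h <;> simp [h]
  have hf := abs_attn_le hM0 hM p (X k)
  set f := attn v E p (X k)
  set Z := ∑ j, Real.exp ⟪p, E (X k j)⟫ with hZ
  have hZpos : 0 < Z := sum_exp_pos (fun j => ⟪p, E (X k j)⟫) i
  have hexp : Real.exp (-⟪p, E (c k) - E (X k i)⟫) =
      Real.exp ⟪p, E (X k i)⟫ / Real.exp ⟪p, E (c k)⟫ := by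
    rw [← Real.exp_sub, inner_sub_right, neg_sub]
  have hw : attnWeight E p (X k) i = Real.exp ⟪p, E (X k i)⟫ / Z := rfl
  have hcZ : Real.exp ⟪p, E (c k)⟫ ≤ Z := by
    obtain ⟨j, hj⟩ := hc k
    rw [← hj]
    exact Finset.single_le_sum (f := fun j => Real.exp ⟪p, E (X k j)⟫)
      (fun j _ => (Real.exp_pos _).le) (Finset.mem_univ j)
  have hZc : Z ≤ ((T + 1) * K) * Real.exp ⟪p, E (c k)⟫ := by
    have : Z ≤ ∑ _j : Fin T, K * Real.exp ⟪p, E (c k)⟫ :=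
      Finset.sum_le_sum fun j _ => hKp p hp k j
    rw [Finset.sum_const, Finset.card_univ, Fintype.card_fin, nsmul_eq_mul] at this
    have h5 : 0 ≤ K * Real.exp ⟪p, E (c k)⟫ := by positivity
    nlinarith
  have hgap : 1 / 4 ≤ y k * (f - ⟪E (X k i), v⟫) := by
    rw [mul_sub]; linarith [hp k, hirr k i hi]
  have hgap' : y k * (f - ⟪E (X k i), v⟫) ≤ 2 * M := by
    refine (le_abs_self _).trans ?_
    rw [abs_mul, hyabs, one_mul]
    exact (abs_sub _ _).trans (by linarith [hM (X k i)])
  have hg : 1 / (1 + Real.exp M) ≤ logisticWeight (y k * f) := by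
    unfold logisticWeight
    refine one_div_le_one_div_of_le (by positivity) ?_
    have : y k * f ≤ M := (le_abs_self _).trans (by rw [abs_mul, hyabs, one_mul]; exact hf)
    linarith [Real.exp_le_exp.2 this]
  have hg0 := (logisticWeight_pos (y k * f)).le
  have hg1 := logisticWeight_le_one (y k * f)
  have hσ1 : attnWeight E p (X k) i ≤ Real.exp (-⟪p, E (c k) - E (X k i)⟫) := by
    rw [hexp, hw]
    exact div_le_div_of_nonneg_left (Real.exp_pos _).le (Real.exp_pos _) hcZ
  have hσ0 : 1 / ((T + 1) * K) * Real.exp (-⟪p, E (c k) - E (X k i)⟫) ≤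
      attnWeight E p (X k) i := by
    rw [hexp, hw, div_mul_div_comm, one_mul]
    exact div_le_div_of_nonneg_left (Real.exp_pos _).le hZpos hZc
  have hσ := softmax_nonneg (fun j => ⟪p, E (X k j)⟫) i
  constructor
  · calc 1 / (1 + Real.exp M) * (1 / ((T + 1) * K)) * (1 / 4) *
          Real.exp (-⟪p, E (c k) - E (X k i)⟫)
        = 1 / (1 + Real.exp M) * (1 / ((T + 1) * K) * Real.exp (-⟪p, E (c k) - E (X k i)⟫)) *
          (1 / 4) := by ring
      _ ≤ pull X y v E p k i := by
          unfold pull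
          gcongr
  · calc pull X y v E p k i
        ≤ 1 * Real.exp (-⟪p, E (c k) - E (X k i)⟫) * (2 * M) := by
          unfold pull
          gcongr
      _ = 2 * M * Real.exp (-⟪p, E (c k) - E (X k i)⟫) := by ring

end Landscape

/-! ### The gradient flow -/

section Flow

variable {S : Type*} {n T d : ℕ} {X : Fin n → Fin T → S} {y : Fin n → ℝ} {v : Emb d}
  {E : S → Emb d} {c : Fin n → S} {pinit : Emb d} {p : ℝ → Emb d}

lemma IsGradientFlow.hasDerivWithinAt_inner (h : IsGradientFlow X y v E pinit p) (q : Emb d)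
    {t : ℝ} (ht : 0 ≤ t) :
    HasDerivWithinAt (fun t => ⟪q, p t⟫) ⟪-gradCls X y v E (p t), q⟫ (Set.Ici 0) t := by
  have := (innerSL ℝ q).hasFDerivAt.comp_hasDerivWithinAt t (h.2 t ht)
  rw [real_inner_comm]
  exact this

lemma IsGradientFlow.loss_le (h : IsGradientFlow X y v E pinit p) {t : ℝ} (ht : 0 ≤ t) :
    loss X y v E (p t) ≤ loss X y v E pinit := by
  have hd : ∀ t, 0 ≤ t → HasDerivWithinAt (fun t => loss X y v E (p t))
      (-‖gradCls X y v E (p t)‖ ^ 2) (Set.Ici 0) t := fun t ht => by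
    have h1 := (hasFDerivAt_loss_cls X y v E (p t)).comp_hasDerivWithinAt t (h.2 t ht)
    have h2 := (hasFDerivAt_loss_cls X y v E (p t)).differentiableAt.hasFDerivAt.unique
      (hasFDerivAt_loss_cls X y v E (p t))
    refine h1.congr_deriv ?_
    rw [← h2, ← inner_gradient_left, inner_neg_right]
    exact congrArg Neg.neg (real_inner_self_eq_norm_sq _)
  have hanti : AntitoneOn (fun t => loss X y v E (p t)) (Set.Ici 0) := by
    refine antitoneOn_of_hasDerivWithinAt_nonpos (f' := fun t => -‖gradCls X y v E (p t)‖ ^ 2)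
      (convex_Ici 0) (fun t ht => (hd t ht).continuousWithinAt)
      (fun t ht => ?_) (fun t _ => neg_nonpos.2 (sq_nonneg _))
    exact (hd t (interior_subset ht)).mono interior_subset
  have := hanti (Set.mem_Ici.2 le_rfl) (Set.mem_Ici.2 ht) ht
  simpa [h.1] using this

/-- Used with `r = 0` for monotonicity and with `r > 0` for linear growth. -/
lemma IsGradientFlow.monotoneOn_inner (h : IsGradientFlow X y v E pinit p) (q : Emb d) (r : ℝ)
    {t₀ : ℝ} (ht₀ : 0 ≤ t₀) (hq : ∀ t, t₀ ≤ t → r ≤ ⟪-gradCls X y v E (p t), q⟫) :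
    MonotoneOn (fun t => ⟪q, p t⟫ - r * t) (Set.Ici t₀) := by
  have hsub : Set.Ici t₀ ⊆ Set.Ici (0 : ℝ) := Set.Ici_subset_Ici.2 ht₀
  have hd : ∀ t ∈ Set.Ici t₀, HasDerivWithinAt (fun t => ⟪q, p t⟫ - r * t)
      (⟪-gradCls X y v E (p t), q⟫ - r) (Set.Ici t₀) t := fun t ht => by
    have h1 := (h.hasDerivWithinAt_inner q (hsub ht)).mono hsub
    exact (h1.fun_sub ((hasDerivWithinAt_id t (Set.Ici t₀)).const_mul r)).congr_deriv
      (by rw [mul_one])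
  exact monotoneOn_of_hasDerivWithinAt_nonneg
    (f' := fun t => ⟪-gradCls X y v E (p t), q⟫ - r) (convex_Ici t₀)
    (fun t ht => (hd t ht).continuousWithinAt)
    (fun t ht => (hd t (interior_subset ht)).mono interior_subset)
    (fun t ht => sub_nonneg.2 (hq t (interior_subset ht)))

/-- Test the velocity `G` against itself: each difference satisfies `⟪G, E (c k) - E (X k i)⟫ ≤ 2 *
M * ‖G‖`, while the same difference has inner product at least `1/4` with `w`. Since the pulls are
nonnegative, `‖G‖ ^ 2 ≤ 8 * M * ‖G‖ * ⟪G, w⟫`. -/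
lemma exists_norm_gradCls_le [Finite S]
    (hirr : ∀ k i, X k i ≠ c k → y k * ⟪E (X k i), v⟫ ≤ 1 / 4)
    {w : Emb d} (hw : ∀ k i, X k i ≠ c k → 1 / 4 ≤ ⟪w, E (c k) - E (X k i)⟫) :
    ∃ C : ℝ, 0 < C ∧ ∀ p, Confident X y v E p →
      ‖gradCls X y v E p‖ ≤ C * ⟪-gradCls X y v E p, w⟫ := by
  obtain ⟨M, hM, hE⟩ := exists_norm_le E
  refine ⟨8 * M, by positivity, fun p hp => ?_⟩
  set G := -gradCls X y v E p with hG
  have hterm : ∀ k i, pull X y v E p k i * ⟪G, E (c k) - E (X k i)⟫ ≤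
      8 * M * ‖G‖ * (pull X y v E p k i * ⟪w, E (c k) - E (X k i)⟫) := fun k i => by
    by_cases hi : X k i = c k
    · simp [hi]
    · have hpos := pull_pos hirr hp hi
      have h1 : ⟪G, E (c k) - E (X k i)⟫ ≤ ‖G‖ * (2 * M) :=
        (real_inner_le_norm _ _).trans (mul_le_mul_of_nonneg_left
          ((norm_sub_le _ _).trans (by linarith [hE (c k), hE (X k i)])) (norm_nonneg _))
      have h2 : ‖G‖ * (2 * M) ≤ 8 * M * ‖G‖ * ⟪w, E (c k) - E (X k i)⟫ := by
        have : 0 ≤ M * ‖G‖ := by positivity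
        nlinarith [mul_le_mul_of_nonneg_left (hw k i hi) this]
      calc _ ≤ pull X y v E p k i * (8 * M * ‖G‖ * ⟪w, E (c k) - E (X k i)⟫) :=
            mul_le_mul_of_nonneg_left (h1.trans h2) hpos.le
        _ = _ := by ring
  have hsq : ‖G‖ * ‖G‖ ≤ ‖G‖ * (8 * M * ⟪G, w⟫) := by
    rw [← real_inner_self_eq_norm_mul_norm]
    nth_rewrite 1 [hG]
    rw [inner_neg_gradCls c]
    calc 1 / (n : ℝ) * ∑ k, ∑ i, pull X y v E p k i * ⟪G, E (c k) - E (X k i)⟫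
        ≤ 1 / (n : ℝ) * ∑ k, ∑ i,
          8 * M * ‖G‖ * (pull X y v E p k i * ⟪w, E (c k) - E (X k i)⟫) := by
          refine mul_le_mul_of_nonneg_left ?_ (by positivity)
          exact Finset.sum_le_sum fun k _ => Finset.sum_le_sum fun i _ => hterm k i
      _ = ‖G‖ * (8 * M * ⟪G, w⟫) := by
          rw [hG, inner_neg_gradCls c]
          simp_rw [← Finset.mul_sum]
          ring
  have hnorm : ‖gradCls X y v E p‖ = ‖G‖ := by rw [hG, norm_neg]
  rw [hnorm]
  rcases (norm_nonneg G).eq_or_lt with h0 | h0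
  · rw [← h0, norm_eq_zero.1 h0.symm]; simp
  · exact le_of_mul_le_mul_left hsq h0

/-- The integrated form of the speed bound: the distance travelled is controlled by the progress
along `w`. -/
lemma IsGradientFlow.norm_sub_le (h : IsGradientFlow X y v E pinit p) {w : Emb d} {C : ℝ}
    (hC : ∀ t, 0 ≤ t → ‖gradCls X y v E (p t)‖ ≤ C * ⟪-gradCls X y v E (p t), w⟫) {t : ℝ}
    (ht : 0 ≤ t) : ‖p t - pinit‖ ≤ C * (⟪w, p t⟫ - ⟪w, pinit⟫) := by
  have hsub : Set.Icc 0 t ⊆ Set.Ici (0 : ℝ) := Set.Icc_subset_Ici_self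
  have hIci : ∀ s ∈ Set.Ico 0 t, ∀ {F : Type} [NormedAddCommGroup F] [NormedSpace ℝ F]
      {f : ℝ → F} {f' : F}, HasDerivWithinAt f f' (Set.Ici 0) s →
      HasDerivWithinAt f f' (Set.Ici s) s :=
    fun s hs _ _ _ _ _ hf => hf.mono (Set.Ici_subset_Ici.2 hs.1)
  refine image_norm_le_of_norm_deriv_right_le_deriv_boundary' (a := 0) (b := t)
    (f := fun s => p s - pinit) (f' := fun s => -gradCls X y v E (p s))
    (B := fun s => C * (⟪w, p s⟫ - ⟪w, pinit⟫))
    (B' := fun s => C * ⟪-gradCls X y v E (p s), w⟫) ?_ ?_ ?_ ?_ ?_ ?_ ⟨ht, le_rfl⟩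
  · exact fun s hs => ((h.2 s hs.1).continuousWithinAt.mono hsub).sub continuousWithinAt_const
  · exact fun s hs => hIci s hs ((h.2 s hs.1).sub_const pinit)
  · simp [h.1]
  · exact fun s hs => ((((h.hasDerivWithinAt_inner w hs.1).continuousWithinAt).mono hsub).sub
      continuousWithinAt_const).const_mul C
  · exact fun s hs => hIci s hs (((h.hasDerivWithinAt_inner w hs.1).sub_const _).const_mul C)
  · exact fun s hs => by rw [norm_neg]; exact hC s hs.1

theorem IsGradientFlow.tendsto_norm_atTop [Finite S] (h : IsGradientFlow X y v E pinit p)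
    (hy : ∀ k, y k = 1 ∨ y k = -1) (hc : ∀ k, Appears (X k) (c k))
    (hirr : ∀ k i, X k i ≠ c k → y k * ⟪E (X k i), v⟫ ≤ 1 / 4)
    (hconf : ∀ t, 0 ≤ t → Confident X y v E (p t))
    {w : Emb d} (hw : ∀ k i, X k i ≠ c k → 1 / 4 ≤ ⟪w, E (c k) - E (X k i)⟫)
    (hex : ∃ k i, X k i ≠ c k) : Tendsto (fun t => ‖p t‖) atTop atTop := by
  obtain ⟨k₀, i₀, hi₀⟩ := hex
  have hn : (0 : ℝ) < n := by exact_mod_cast k₀.pos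
  obtain ⟨C, hC0, hC⟩ := exists_norm_gradCls_le hirr hw
  obtain ⟨A, _, hA, _, hAB⟩ := exists_pull_bounds hy hc hirr
  obtain ⟨M, hM, hE⟩ := exists_norm_le E
  have hnonneg : ∀ t, 0 ≤ t → ∀ k i,
      0 ≤ pull X y v E (p t) k i * ⟪w, E (c k) - E (X k i)⟫ := fun t ht k i => by
    by_cases hi : X k i = c k
    · simp [hi]
    · exact mul_nonneg (pull_pos hirr (hconf t ht) hi).le (by linarith [hw k i hi])
  have hlb : ∀ t, 0 ≤ t → 1 / (n : ℝ) * (A * Real.exp (-(2 * M * ‖p t‖)) * (1 / 4)) ≤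
      ⟪-gradCls X y v E (p t), w⟫ := fun t ht => by
    rw [inner_neg_gradCls c]
    refine mul_le_mul_of_nonneg_left ?_ (by positivity)
    calc A * Real.exp (-(2 * M * ‖p t‖)) * (1 / 4)
        ≤ pull X y v E (p t) k₀ i₀ * ⟪w, E (c k₀) - E (X k₀ i₀)⟫ := by
          refine mul_le_mul (le_trans ?_ (hAB _ (hconf t ht) k₀ i₀ hi₀).1) (hw k₀ i₀ hi₀)
            (by norm_num) (pull_pos hirr (hconf t ht) hi₀).le
          refine mul_le_mul_of_nonneg_left (Real.exp_le_exp.2 (neg_le_neg ?_)) hA.le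
          refine (real_inner_le_norm _ _).trans ?_
          rw [mul_comm]
          refine mul_le_mul_of_nonneg_right ?_ (norm_nonneg _)
          exact (_root_.norm_sub_le _ _).trans (by linarith [hE (c k₀), hE (X k₀ i₀)])
      _ ≤ ∑ i, pull X y v E (p t) k₀ i * ⟪w, E (c k₀) - E (X k₀ i)⟫ :=
          Finset.single_le_sum (f := fun i => pull X y v E (p t) k₀ i *
            ⟪w, E (c k₀) - E (X k₀ i)⟫) (fun i _ => hnonneg t ht k₀ i) (Finset.mem_univ i₀)
      _ ≤ _ := Finset.single_le_sum (f := fun k => ∑ i, pull X y v E (p t) k i *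
            ⟪w, E (c k) - E (X k i)⟫)
            (fun k _ => Finset.sum_nonneg fun i _ => hnonneg t ht k i) (Finset.mem_univ k₀)
  have hmono : MonotoneOn (fun t => ⟪w, p t⟫) (Set.Ici 0) := by
    have := h.monotoneOn_inner w 0 le_rfl fun t ht => le_trans (by positivity) (hlb t ht)
    simpa using this
  -- If `⟪w, p t⟫` were bounded, `norm_sub_le` would confine the flow to a ball of radius `R`; there
  -- the pull of the pair `(k₀, i₀)` is bounded below, so `⟪w, p t⟫` would grow at a rate at least
  -- `ρ > 0`.
  have hunb : ∀ b : ℝ, ∃ t, 0 ≤ t ∧ b < ⟪w, p t⟫ := by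
    by_contra! hcon
    obtain ⟨b, hb⟩ := hcon
    set R := ‖pinit‖ + C * (b - ⟪w, pinit⟫)
    have hR : ∀ t, 0 ≤ t → ‖p t‖ ≤ R := fun t ht => by
      have h1 := h.norm_sub_le (fun t ht => hC _ (hconf t ht)) ht
      have h2 : ‖p t‖ ≤ ‖p t - pinit‖ + ‖pinit‖ := by
        simpa using norm_add_le (p t - pinit) pinit
      have h3 := mul_le_mul_of_nonneg_left (sub_le_sub_right (hb t ht) ⟪w, pinit⟫) hC0.le
      linarith
    set ρ := 1 / (n : ℝ) * (A * Real.exp (-(2 * M * R)) * (1 / 4)) with hρ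
    have hρ0 : 0 < ρ := by positivity
    have hm := h.monotoneOn_inner w ρ le_rfl fun t ht => le_trans (by
      rw [hρ]
      gcongr
      exact hR t ht) (hlb t ht)
    have ht1 : 0 ≤ (|b| + |⟪w, pinit⟫| + 1) / ρ := by positivity
    have h1 := hm (Set.mem_Ici.2 le_rfl) (Set.mem_Ici.2 ht1) ht1
    simp only [h.1, mul_zero, sub_zero, mul_div_cancel₀ _ hρ0.ne'] at h1
    have h2 := hb _ ht1
    linarith [le_abs_self b, neg_abs_le ⟪w, pinit⟫]
  refine tendsto_atTop.2 fun b => ?_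
  obtain ⟨t₀, ht₀, hb⟩ := hunb ((‖w‖ + 1) * b)
  filter_upwards [eventually_ge_atTop t₀] with t ht
  have h1 : ⟪w, p t₀⟫ ≤ ⟪w, p t⟫ := hmono ht₀ (ht₀.trans ht) ht
  have h2 : ⟪w, p t⟫ ≤ (‖w‖ + 1) * ‖p t‖ :=
    (real_inner_le_norm _ _).trans (mul_le_mul_of_nonneg_right (by linarith) (norm_nonneg _))
  exact (lt_of_mul_lt_mul_left (hb.trans_le (h1.trans h2)) (by positivity)).le

end Flow

/-! ### The limit direction of the gradient flow -/

section Selected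

variable {S : Type*} {n T d : ℕ} {E : S → Emb d} {x : Fin T → S} {p : Emb d}

lemma inner_eq_of_mem_selected {s s' : S} (hs : s ∈ selected E x p) (hs' : s' ∈ selected E x p) :
    ⟪p, E s - E s'⟫ = 0 := by
  rw [inner_sub_right]
  linarith [hs.2 s' hs'.1, hs'.2 s hs.1]

lemma inner_pos_of_notMem_selected {s s' : S} (hs : s ∈ selected E x p) (hs' : Appears x s')
    (h : s' ∉ selected E x p) : 0 < ⟪p, E s - E s'⟫ := by
  rw [inner_sub_right, sub_pos]
  by_contra! hle
  exact h ⟨hs', fun s'' hs'' => (hs.2 s'' hs'').trans hle⟩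

lemma selected_smul {r : ℝ} (hr : 0 < r) : selected E x (r • p) = selected E x p := by
  ext s
  simp only [selected, Set.mem_ofPred_eq, real_inner_smul_left, mul_le_mul_iff_right₀ hr]

/-- If `m⁻¹ • u` is feasible and `m • u` has inner product at least `1` with every feasible point,
then the unit vector `u` is the only max-margin direction. -/
lemma maxMarginDirections_eq_singleton {X : Fin n → Fin T → S} {q u : Emb d} {m : ℝ} (hm : 0 < m)
    (hu : ‖u‖ = 1) (hmem : m⁻¹ • u ∈ marginFeasible E X q)
    (hle : ∀ p ∈ marginFeasible E X q, 1 ≤ m * ⟪p, u⟫) : maxMarginDirections E X q = {u} := by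
  have hnorm : ‖m⁻¹ • u‖ = m⁻¹ := by
    rw [norm_smul, hu, mul_one, Real.norm_of_nonneg (inv_pos.2 hm).le]
  have hge : ∀ p ∈ marginFeasible E X q, m⁻¹ ≤ ⟪p, u⟫ := fun p hp => by
    rw [inv_le_iff_one_le_mul₀' hm]; exact hle p hp
  ext z
  simp only [Set.mem_singleton_iff]
  constructor
  · rintro ⟨phat, hphat, hmin, rfl⟩
    have h1 : ‖phat‖ ≤ m⁻¹ := hnorm ▸ hmin _ hmem
    have h2 := hge phat hphat
    -- Expanding the square with `‖phat‖ ≤ m⁻¹` and `⟪phat, u⟫ ≥ m⁻¹` gives at most `m⁻² - 2 m⁻² +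
    -- m⁻² = 0`.
    have h3 : ‖phat - m⁻¹ • u‖ ^ 2 ≤ 0 := by
      rw [norm_sub_sq_real, hnorm, real_inner_smul_right]
      have : 0 < m⁻¹ := inv_pos.2 hm
      nlinarith [norm_nonneg phat]
    have h4 : phat = m⁻¹ • u := by
      rw [← sub_eq_zero, ← norm_eq_zero]
      exact pow_eq_zero_iff (two_ne_zero) |>.1 (le_antisymm h3 (sq_nonneg _))
    rw [h4, hnorm, inv_inv, smul_smul, mul_inv_cancel₀ hm.ne', one_smul]
  · rintro rfl
    refine ⟨m⁻¹ • z, hmem, fun p hp => ?_, ?_⟩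
    · rw [hnorm]
      refine (hge p hp).trans ((real_inner_le_norm _ _).trans ?_)
      rw [hu, mul_one]
    · rw [hnorm, inv_inv, smul_smul, mul_inv_cancel₀ hm.ne', one_smul]

end Selected

section Limit

variable {S : Type*} {n T d : ℕ} {X : Fin n → Fin T → S} {y : Fin n → ℝ} {v : Emb d}
  {E : S → Emb d} {c : Fin n → S} {pinit pinf : Emb d} {p : ℝ → Emb d}

lemma norm_eq_one_of_tendsto_direction (hnorm : Tendsto (fun t => ‖p t‖) atTop atTop)
    (hlim : Tendsto (fun t => (‖p t‖)⁻¹ • p t) atTop (𝓝 pinf)) : ‖pinf‖ = 1 := by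
  refine tendsto_nhds_unique hlim.norm (tendsto_const_nhds.congr' ?_)
  filter_upwards [hnorm.eventually_gt_atTop 0] with t ht
  rw [norm_smul, norm_inv, norm_norm, inv_mul_cancel₀ ht.ne']

lemma tendsto_inner_direction (hlim : Tendsto (fun t => (‖p t‖)⁻¹ • p t) atTop (𝓝 pinf))
    (q : Emb d) : Tendsto (fun t => (‖p t‖)⁻¹ * ⟪q, p t⟫) atTop (𝓝 ⟪q, pinf⟫) := by
  have := (tendsto_const_nhds (x := q)).inner (𝕜 := ℝ) hlim
  simpa only [real_inner_smul_right] using this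

lemma inner_direction_nonneg (hnorm : Tendsto (fun t => ‖p t‖) atTop atTop)
    (hlim : Tendsto (fun t => (‖p t‖)⁻¹ • p t) atTop (𝓝 pinf)) {q : Emb d} {b : ℝ}
    (hb : ∀ᶠ t in atTop, b ≤ ⟪q, p t⟫) : 0 ≤ ⟪q, pinf⟫ := by
  have h0 : Tendsto (fun t => (‖p t‖)⁻¹ * b) atTop (𝓝 0) := by
    simpa using (tendsto_inv_atTop_zero.comp hnorm).mul_const b
  refine le_of_tendsto_of_tendsto h0 (tendsto_inner_direction hlim q) ?_
  filter_upwards [hb] with t ht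
  exact mul_le_mul_of_nonneg_left ht (inv_nonneg.2 (norm_nonneg _))

/-- An eventually nonnegative velocity along `q` keeps `⟪q, p t⟫` bounded below, and division by `‖p
t‖ → ∞` removes the bound. Optimality of the limit is proved by choosing suitable test vectors `q`.
-/
lemma IsGradientFlow.inner_direction_nonneg (h : IsGradientFlow X y v E pinit p)
    (hnorm : Tendsto (fun t => ‖p t‖) atTop atTop)
    (hlim : Tendsto (fun t => (‖p t‖)⁻¹ • p t) atTop (𝓝 pinf)) {q : Emb d}
    (hq : ∀ᶠ t in atTop, 0 ≤ ⟪-gradCls X y v E (p t), q⟫) : 0 ≤ ⟪q, pinf⟫ := by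
  obtain ⟨t₁, ht₁⟩ := eventually_atTop.1 hq
  have hm := h.monotoneOn_inner q 0 (le_max_right t₁ 0)
    fun t ht => ht₁ t ((le_max_left _ _).trans ht)
  refine ClsAttention.inner_direction_nonneg hnorm hlim (b := ⟪q, p (max t₁ 0)⟫) ?_
  filter_upwards [eventually_ge_atTop (max t₁ 0)] with t ht
  simpa using hm (Set.mem_Ici.2 le_rfl) (Set.mem_Ici.2 ht) ht

lemma tendsto_inner_atTop (hnorm : Tendsto (fun t => ‖p t‖) atTop atTop)
    (hlim : Tendsto (fun t => (‖p t‖)⁻¹ • p t) atTop (𝓝 pinf)) {q : Emb d}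
    (hq : 0 < ⟪q, pinf⟫) : Tendsto (fun t => ⟪q, p t⟫) atTop atTop := by
  refine ((tendsto_inner_direction hlim q).pos_mul_atTop hq hnorm).congr' ?_
  filter_upwards [hnorm.eventually_gt_atTop 0] with t ht
  field_simp

/-- The completely positive or negative token of every sequence is selected in the limit. -/
theorem mem_selected_direction [Finite S]
    (hy : ∀ k, y k = 1 ∨ y k = -1) (hc : ∀ k, Appears (X k) (c k))
    (hirr : ∀ k i, X k i ≠ c k → y k * ⟪E (X k i), v⟫ ≤ 1 / 4)
    (hconf : ∀ t, 0 ≤ t → Confident X y v E (p t))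
    (hnorm : Tendsto (fun t => ‖p t‖) atTop atTop)
    (hlim : Tendsto (fun t => (‖p t‖)⁻¹ • p t) atTop (𝓝 pinf)) (k : Fin n) :
    c k ∈ selected E (X k) pinf := by
  obtain ⟨K, hK, hKp⟩ := exists_exp_inner_le hy hirr
  refine ⟨hc k, ?_⟩
  rintro _ ⟨i, rfl⟩
  have := inner_direction_nonneg hnorm hlim (q := E (c k) - E (X k i)) (b := -Real.log K) (by
    filter_upwards [eventually_ge_atTop 0] with t ht
    have h1 := hKp (p t) (hconf t ht) k i
    rw [← Real.exp_log hK, ← Real.exp_add, Real.exp_le_exp] at h1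
    rw [real_inner_comm, inner_sub_right]
    linarith)
  rw [real_inner_comm, inner_sub_right] at this
  linarith

/-- The test vector `(m + ε) • q - pinf` replaces a duality argument. A token of margin at most `m +
ε` gives a nonnegative term since `q` has margin at least `1`, and `(k₀, i₀)` itself gives at least
`ε` times its pull. The remaining tokens may give negative terms, but their pulls are negligible
against that of `(k₀, i₀)`. -/
lemma one_le_margin_mul_inner [Finite S] (h : IsGradientFlow X y v E pinit p)
    (hy : ∀ k, y k = 1 ∨ y k = -1) (hc : ∀ k, Appears (X k) (c k))
    (hirr : ∀ k i, X k i ≠ c k → y k * ⟪E (X k i), v⟫ ≤ 1 / 4)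
    (hconf : ∀ t, 0 ≤ t → Confident X y v E (p t))
    (hnorm : Tendsto (fun t => ‖p t‖) atTop atTop)
    (hlim : Tendsto (fun t => (‖p t‖)⁻¹ • p t) atTop (𝓝 pinf))
    {k₀ : Fin n} {i₀ : Fin T} (hi₀ : X k₀ i₀ ∉ selected E (X k₀) pinf)
    {q : Emb d} (hq : q ∈ marginFeasible E X pinf) :
    1 ≤ ⟪pinf, E (c k₀) - E (X k₀ i₀)⟫ * ⟪q, pinf⟫ := by
  have hsel := mem_selected_direction hy hc hirr hconf hnorm hlim
  have hne : ∀ {k i}, X k i ∉ selected E (X k) pinf → X k i ≠ c k :=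
    fun hi heq => hi (heq ▸ hsel _)
  obtain ⟨A, B, hA, hB, hAB⟩ := exists_pull_bounds hy hc hirr
  set m := ⟪pinf, E (c k₀) - E (X k₀ i₀)⟫ with hm
  have hN : (0 : ℝ) < n * T :=
    mul_pos (by exact_mod_cast k₀.pos) (by exact_mod_cast i₀.pos)
  have key : ∀ ε : ℝ, 0 < ε → 0 ≤ ⟪(m + ε) • q - pinf, pinf⟫ := fun ε hε => by
    refine h.inner_direction_nonneg hnorm hlim ?_
    -- The gain `pull * ε` at `(k₀, i₀)` is split into `n * T` equal shares, one per position, to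
    -- absorb a possible loss there; the lower bounds then sum to exactly zero.
    have hterm : ∀ j : Fin n × Fin T, ∀ᶠ t in atTop,
        (if j = (k₀, i₀) then pull X y v E (p t) k₀ i₀ * ε else 0) -
          pull X y v E (p t) k₀ i₀ * ε / (n * T) ≤
        pull X y v E (p t) j.1 j.2 * ⟪(m + ε) • q - pinf, E (c j.1) - E (X j.1 j.2)⟫ := by
      rintro ⟨k, i⟩
      dsimp only
      have hQ₀ : ∀ t, 0 ≤ t → 0 < pull X y v E (p t) k₀ i₀ := fun t ht =>
        pull_pos hirr (hconf t ht) (hne hi₀)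
      rw [inner_sub_left, real_inner_smul_left]
      -- A selected token ties with `c k` for `pinf`, and also for `q`, which has the same
      -- selection, so its term vanishes.
      by_cases hi : X k i ∈ selected E (X k) pinf
      · have hneq : (k, i) ≠ (k₀, i₀) := by
          rintro ⟨⟩
          exact hi₀ hi
        rw [inner_eq_of_mem_selected (hsel k) hi,
          inner_eq_of_mem_selected (p := q) (x := X k) (hq.1 k ▸ hsel k) (hq.1 k ▸ hi)]
        filter_upwards [eventually_ge_atTop 0] with t ht
        have := hQ₀ t ht
        rw [if_neg hneq]
        simp only [mul_zero, sub_zero, zero_sub, Left.neg_nonpos_iff]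
        positivity
      · have hq1 := hq.2 k (c k) (hsel k) (X k i) ⟨i, rfl⟩ hi
        set μ := ⟪pinf, E (c k) - E (X k i)⟫ with hμ
        rcases le_or_gt μ (m + ε) with hle | hlt
        · filter_upwards [eventually_ge_atTop 0] with t ht
          have h0 := hQ₀ t ht
          have hpos := pull_pos hirr (hconf t ht) (hne hi)
          have h1 : 0 ≤ pull X y v E (p t) k₀ i₀ * ε / (n * T) := by positivity
          split_ifs with heq
          · obtain ⟨rfl, rfl⟩ := Prod.mk.inj heq
            have h2 : ε ≤ (m + ε) * ⟪q, E (c k) - E (X k i)⟫ - μ := by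
              have h3 : 0 ≤ m := (inner_pos_of_notMem_selected (hsel k) ⟨i, rfl⟩ hi).le
              have h4 : μ = m := rfl
              nlinarith
            linarith [mul_le_mul_of_nonneg_left h2 hpos.le]
          · have h2 : 0 ≤ (m + ε) * ⟪q, E (c k) - E (X k i)⟫ - μ := by
              have h3 : 0 < m := inner_pos_of_notMem_selected (hsel k₀) ⟨i₀, rfl⟩ hi₀
              nlinarith
            linarith [mul_nonneg hpos.le h2]
        · have hneq : (k, i) ≠ (k₀, i₀) := by
            rintro ⟨⟩
            linarith
          -- A strictly larger margin in the limit direction makes the difference of the two score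
          -- gaps tend to infinity along the flow, so the ratio of the pulls tends to zero.
          have hgap : 0 < ⟪(E (c k) - E (X k i)) - (E (c k₀) - E (X k₀ i₀)), pinf⟫ := by
            rw [real_inner_comm, inner_sub_right]
            linarith
          have htop := tendsto_inner_atTop hnorm hlim hgap
          have hbound : 0 < A * ε / (n * T) / (B * (μ - m)) := by
            have : 0 < μ - m := by linarith
            positivity
          have hsmall := (Real.tendsto_exp_atBot.comp (tendsto_neg_atTop_atBot.comp htop)).eventually
            (gt_mem_nhds hbound)
          filter_upwards [eventually_ge_atTop 0, hsmall] with t ht hs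
          rw [if_neg hneq, zero_sub]
          simp only [Function.comp_apply] at hs
          have hup := (hAB _ (hconf t ht) k i (hne hi)).2
          have hlo := (hAB _ (hconf t ht) k₀ i₀ (hne hi₀)).1
          have hpos := pull_pos hirr (hconf t ht) (hne hi)
          have hBμ : 0 < B * (μ - m) := mul_pos hB (by linarith)
          have hm0 : 0 < m := inner_pos_of_notMem_selected (hsel k₀) ⟨i₀, rfl⟩ hi₀
          rw [lt_div_iff₀ hBμ] at hs
          have hsplit : Real.exp (-⟪p t, E (c k) - E (X k i)⟫) =
              Real.exp (-⟪(E (c k) - E (X k i)) - (E (c k₀) - E (X k₀ i₀)), p t⟫) *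
                Real.exp (-⟪p t, E (c k₀) - E (X k₀ i₀)⟫) := by
            rw [← Real.exp_add, real_inner_comm (p t),
              inner_sub_right (p t) (E (c k) - E (X k i)) (E (c k₀) - E (X k₀ i₀))]
            congr 1
            ring
          have h1 : pull X y v E (p t) k i * (μ - m) ≤ pull X y v E (p t) k₀ i₀ * ε / (n * T) := by
            calc pull X y v E (p t) k i * (μ - m)
                ≤ B * Real.exp (-⟪p t, E (c k) - E (X k i)⟫) * (μ - m) :=
                  mul_le_mul_of_nonneg_right hup (by linarith)
              _ = Real.exp (-⟪(E (c k) - E (X k i)) - (E (c k₀) - E (X k₀ i₀)), p t⟫) *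
                    (B * (μ - m)) * Real.exp (-⟪p t, E (c k₀) - E (X k₀ i₀)⟫) := by
                  rw [hsplit]; ring
              _ ≤ A * ε / (n * T) * Real.exp (-⟪p t, E (c k₀) - E (X k₀ i₀)⟫) :=
                  mul_le_mul_of_nonneg_right hs.le (Real.exp_pos _).le
              _ = A * Real.exp (-⟪p t, E (c k₀) - E (X k₀ i₀)⟫) * ε / (n * T) := by ring
              _ ≤ _ := by gcongr
          have h2 : -(μ - m) ≤ (m + ε) * ⟪q, E (c k) - E (X k i)⟫ - μ := by nlinarith
          nlinarith [mul_le_mul_of_nonneg_left h2 hpos.le]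
    filter_upwards [eventually_all.2 hterm] with t ht
    rw [inner_neg_gradCls c, ← Fintype.sum_prod_type']
    refine mul_nonneg (by positivity) (le_trans (le_of_eq ?_)
      (Finset.sum_le_sum fun j _ => ht j))
    rw [Finset.sum_sub_distrib, Finset.sum_ite_eq' Finset.univ (k₀, i₀), Finset.sum_const,
      Finset.card_univ, Fintype.card_prod, Fintype.card_fin, Fintype.card_fin]
    simp only [Finset.mem_univ, if_true, nsmul_eq_mul, Nat.cast_mul]
    rw [mul_div_cancel₀ _ hN.ne', sub_self]
  have hpinf := norm_eq_one_of_tendsto_direction hnorm hlim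
  simp only [inner_sub_left, real_inner_smul_left, real_inner_self_eq_norm_sq, hpinf] at key
  have hten : Tendsto (fun ε : ℝ => (m + ε) * ⟪q, pinf⟫ - 1 ^ 2) (𝓝[>] 0)
      (𝓝 ((m + 0) * ⟪q, pinf⟫ - 1 ^ 2)) :=
    Tendsto.mono_left (Continuous.tendsto (by fun_prop) 0) nhdsWithin_le_nhds
  have := ge_of_tendsto hten (eventually_mem_nhdsWithin.mono fun ε hε => key ε hε)
  linarith

/-- The limit direction of the gradient flow is the max-margin direction for its selection. -/
theorem IsGradientFlow.maxMarginDirections_eq [Finite S] (h : IsGradientFlow X y v E pinit p)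
    (hy : ∀ k, y k = 1 ∨ y k = -1) (hc : ∀ k, Appears (X k) (c k))
    (hirr : ∀ k i, X k i ≠ c k → y k * ⟪E (X k i), v⟫ ≤ 1 / 4)
    (hconf : ∀ t, 0 ≤ t → Confident X y v E (p t))
    (hnorm : Tendsto (fun t => ‖p t‖) atTop atTop)
    (hlim : Tendsto (fun t => (‖p t‖)⁻¹ • p t) atTop (𝓝 pinf)) :
    maxMarginDirections E X pinf = {pinf} := by
  have hsel := mem_selected_direction hy hc hirr hconf hnorm hlim
  have hpinf := norm_eq_one_of_tendsto_direction hnorm hlim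
  -- If every token were selected, all differences would be orthogonal to `pinf`, so `⟪pinf, p t⟫`
  -- would not move; this contradicts `‖pinf‖ = 1`.
  have hne : ∃ j : Fin n × Fin T, X j.1 j.2 ∉ selected E (X j.1) pinf := by
    by_contra! hall
    have := h.inner_direction_nonneg hnorm hlim (q := -pinf) (Eventually.of_forall fun t => by
      rw [inner_neg_gradCls c]
      refine le_of_eq (Eq.symm ?_)
      have h0 : ∀ k i, ⟪-pinf, E (c k) - E (X k i)⟫ = 0 := fun k i => by
        rw [inner_neg_left, inner_eq_of_mem_selected (hsel k) (hall (k, i)), neg_zero]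
      simp [h0])
    rw [inner_neg_left, real_inner_self_eq_norm_sq, hpinf] at this
    norm_num at this
  -- Minimality of the margin is what makes `m⁻¹ • pinf` feasible.
  obtain ⟨⟨k₀, i₀⟩, hi₀, hmin⟩ := Set.exists_min_image
    {j : Fin n × Fin T | X j.1 j.2 ∉ selected E (X j.1) pinf}
    (fun j => ⟪pinf, E (c j.1) - E (X j.1 j.2)⟫) (Set.toFinite _) hne
  have hm := inner_pos_of_notMem_selected (hsel k₀) ⟨i₀, rfl⟩ hi₀
  refine maxMarginDirections_eq_singleton hm hpinf
    ⟨fun k => selected_smul (inv_pos.2 hm), fun k s hs s' hs' hns => ?_⟩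
    fun q hq => one_le_margin_mul_inner h hy hc hirr hconf hnorm hlim hi₀ hq
  obtain ⟨i, rfl⟩ := hs'
  have h1 := hmin (k, i) hns
  have h2 := inner_eq_of_mem_selected hs (hsel k)
  rw [inner_sub_right] at h2
  rw [real_inner_smul_left, inv_mul_eq_div, one_le_div hm]
  refine h1.trans ?_
  rw [inner_sub_right, inner_sub_right]
  linarith

end Limit

/-! ### The first gradient step from a nearly orthogonal initialization -/

lemma abs_logisticWeight_sub_half_le {z : ℝ} (hz : |z| ≤ 1) : |logisticWeight z - 1 / 2| ≤ |z| := by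
  have hpos : 0 < 1 + Real.exp z := by positivity
  have h1 : logisticWeight z - 1 / 2 = -(Real.exp z - 1) / (2 * (1 + Real.exp z)) := by
    unfold logisticWeight
    field_simp
    ring
  rw [h1, abs_div, abs_neg, abs_of_pos (by positivity : 0 < 2 * (1 + Real.exp z)),
    div_le_iff₀ (by positivity)]
  have h2 := Real.abs_exp_sub_one_le hz
  nlinarith [Real.exp_pos z, abs_nonneg z, mul_nonneg (abs_nonneg z) (Real.exp_pos z).le]

/-! ### Softmax of small scores is nearly uniform -/

section Softmax

variable {T : ℕ} {a : Fin T → ℝ} {τ : ℝ}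

lemma le_softmax (ha : ∀ i, |a i| ≤ τ) (i : Fin T) : (1 - 2 * τ) / T ≤ softmax a i := by
  have hT : (0 : ℝ) < T := by exact_mod_cast i.pos
  have hZ : ∑ j, Real.exp (a j) ≤ T * Real.exp τ := by
    refine (Finset.sum_le_sum fun j _ => Real.exp_le_exp.2 ((le_abs_self _).trans (ha j))).trans ?_
    simp
  have h1 : Real.exp (-(2 * τ)) / T ≤ softmax a i := by
    have : Real.exp (-(2 * τ)) / T = Real.exp (-τ) / (T * Real.exp τ) := by
      rw [mul_comm (T : ℝ), ← div_div, ← Real.exp_sub]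
      ring_nf
    rw [this]
    exact div_le_div₀ (Real.exp_pos _).le (Real.exp_le_exp.2 (neg_le_of_abs_le (ha i)))
      (sum_exp_pos a i) hZ
  refine le_trans (div_le_div_of_nonneg_right ?_ hT.le) h1
  linarith [Real.add_one_le_exp (-(2 * τ))]

lemma softmax_le (ha : ∀ i, |a i| ≤ τ) (hτ : 2 * τ ≤ 1) (i : Fin T) :
    softmax a i ≤ (1 + 4 * τ) / T := by
  have hT : (0 : ℝ) < T := by exact_mod_cast i.pos
  have hτ0 : 0 ≤ τ := (abs_nonneg _).trans (ha i)
  have hZ : T * Real.exp (-τ) ≤ ∑ j, Real.exp (a j) := by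
    refine le_trans ?_
      (Finset.sum_le_sum fun j _ => Real.exp_le_exp.2 (neg_le_of_abs_le (ha j)))
    simp
  have h1 : softmax a i ≤ Real.exp (2 * τ) / T := by
    have : Real.exp (2 * τ) / T = Real.exp τ / (T * Real.exp (-τ)) := by
      rw [mul_comm (T : ℝ), ← div_div, ← Real.exp_sub]
      ring_nf
    rw [this]
    exact div_le_div₀ (Real.exp_pos _).le (Real.exp_le_exp.2 ((le_abs_self _).trans (ha i)))
      (by positivity) hZ
  refine h1.trans (div_le_div_of_nonneg_right ?_ hT.le)
  have h2 := Real.abs_exp_sub_one_le (x := 2 * τ) (by rwa [abs_of_nonneg (by positivity)])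
  rw [abs_of_nonneg (by positivity : 0 ≤ 2 * τ)] at h2
  linarith [le_abs_self (Real.exp (2 * τ) - 1)]

end Softmax

/-- The embeddings `E`, `p` and the unit vector `v` are orthogonal up to `τ`, and the embeddings
have norm of order one. -/
structure NearOrthogonal {S : Type*} {d : ℕ} (τ : ℝ) (v : Emb d) (E : S → Emb d) (p : Emb d) :
    Prop where
  tok_dir : ∀ s, |⟪E s, v⟫| ≤ τ
  cls_dir : |⟪p, v⟫| ≤ τ
  tok_cls : ∀ s, |⟪E s, p⟫| ≤ τ
  tok_tok : ∀ s s', s ≠ s' → |⟪E s, E s'⟫| ≤ τ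
  half_le_tok : ∀ s, 1 / 2 ≤ ‖E s‖ ^ 2
  tok_le : ∀ s, ‖E s‖ ^ 2 ≤ 2
  cls_le : ‖p‖ ^ 2 ≤ 2

/-! ### Signed frequencies of complete tokens -/

section Dataset

variable {S : Type*} [DecidableEq S] {n T : ℕ} {X : Fin n → Fin T → S} {y : Fin n → ℝ}

lemma abs_label (hy : ∀ k, y k = 1 ∨ y k = -1) (k : Fin n) : |y k| = 1 := by
  rcases hy k with h | h <;> simp [h]

/-- All sequences containing a complete token share one label, so no cancellation occurs and the sum
counts at least one occurrence. -/
lemma inv_le_label_mul_signedFreq {s : S} (hs : s ∈ completeTokens X y) {k : Fin n} (hk : Appears (X k) s) :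
    1 / ((n : ℝ) * T) ≤ y k * signedFreq X y s := by
  obtain ⟨i, hi⟩ := hk
  have hlab : ∀ k', Appears (X k') s → y k * y k' = 1 := fun k' hk' => by
    rcases hs with h | h
    · rw [h k ⟨i, hi⟩, h k' hk', one_mul]
    · rw [h k ⟨i, hi⟩, h k' hk']; norm_num
  have hterm : ∀ k', y k * (y k' * ∑ i, if X k' i = s then (1 : ℝ) else 0) =
      ∑ i, if X k' i = s then (1 : ℝ) else 0 := fun k' => by
    by_cases h : Appears (X k') s
    · rw [← mul_assoc, hlab k' h, one_mul]
    · have : ∀ i, X k' i ≠ s := fun i hi => h ⟨i, hi⟩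
      simp [this]
  have hnonneg : ∀ k', 0 ≤ ∑ i, if X k' i = s then (1 : ℝ) else 0 := fun k' =>
    Finset.sum_nonneg fun i _ => by split_ifs <;> norm_num
  have hone : 1 ≤ ∑ k', y k * (y k' * ∑ i, if X k' i = s then (1 : ℝ) else 0) := by
    rw [Finset.sum_congr rfl fun k' _ => hterm k']
    refine le_trans ?_ (Finset.single_le_sum (fun k' _ => hnonneg k') (Finset.mem_univ k))
    refine le_trans ?_ (Finset.single_le_sum (fun i _ => by split_ifs <;> norm_num)
      (Finset.mem_univ i))
    rw [if_pos hi]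
  rw [signedFreq, mul_left_comm, Finset.mul_sum]
  exact le_mul_of_one_le_right (by positivity) hone

lemma not_irrelevant_of_complete {s : S} (hs : s ∈ completeTokens X y) {k : Fin n} (hk : Appears (X k) s) : ¬Irrelevant X y s := by
  intro h
  have h1 := inv_le_label_mul_signedFreq hs hk
  rw [h, mul_zero] at h1
  have hn : (0 : ℝ) < n := by exact_mod_cast k.pos
  have hT : (0 : ℝ) < T := by exact_mod_cast hk.choose.pos
  exact absurd h1 (not_le.2 (by positivity))

end Dataset

lemma card_vocab_le {S : Type*} [Fintype S] {n T : ℕ} {X : Fin n → Fin T → S}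
    (hvocab : ∀ s : S, ∃ k, Appears (X k) s) :
    (Fintype.card S : ℝ) ≤ n * T := by
  have h := Fintype.card_le_of_surjective (fun j : Fin n × Fin T => X j.1 j.2) fun s => by
    obtain ⟨k, i, hi⟩ := hvocab s
    exact ⟨(k, i), hi⟩
  rw [Fintype.card_prod, Fintype.card_fin, Fintype.card_fin] at h
  exact_mod_cast h

/-! ### Size of the first gradient step -/

section FirstStep

variable {S : Type*} {n T d : ℕ} {X : Fin n → Fin T → S} {y : Fin n → ℝ} {v : Emb d}
  {E : S → Emb d} {p : Emb d} {τ η : ℝ}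

lemma NearOrthogonal.norm_tok_le (h : NearOrthogonal τ v E p) (s : S) : ‖E s‖ ≤ 2 := by
  nlinarith [h.tok_le s, norm_nonneg (E s)]

lemma NearOrthogonal.norm_cls_le (h : NearOrthogonal τ v E p) : ‖p‖ ≤ 2 := by
  nlinarith [h.cls_le, norm_nonneg p]

lemma NearOrthogonal.nonneg (h : NearOrthogonal τ v E p) : 0 ≤ τ := (abs_nonneg _).trans h.cls_dir

lemma NearOrthogonal.abs_attn_le (h : NearOrthogonal τ v E p) (x : Fin T → S) :
    |attn v E p x| ≤ τ :=
  ClsAttention.abs_attn_le h.nonneg h.tok_dir p x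

/-- A bound for the averages over the dataset which occur in the gradients. -/
lemma abs_average_le (hn : 0 < n) {b : ℝ} {u : Fin n → ℝ} (hu : ∀ k, |u k| ≤ b) :
    |1 / (n : ℝ) * ∑ k, u k| ≤ b := by
  have hn' : (0 : ℝ) < n := by exact_mod_cast hn
  rw [abs_mul, abs_of_pos (by positivity), one_div_mul_eq_div, div_le_iff₀ hn']
  refine (Finset.abs_sum_le_sum_abs _ _).trans ((Finset.sum_le_sum fun k _ => hu k).trans ?_)
  simp [mul_comm]

lemma abs_softmax_average_le {a u : Fin T → ℝ} {b : ℝ} (hb : 0 ≤ b) (hu : ∀ i, |u i| ≤ b) :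
    |∑ i, softmax a i * u i| ≤ b := by
  refine (Finset.abs_sum_le_sum_abs _ _).trans ?_
  calc ∑ i, |softmax a i * u i| ≤ ∑ i, softmax a i * b := Finset.sum_le_sum fun i _ => by
        rw [abs_mul, abs_of_nonneg (softmax_nonneg _ _)]
        exact mul_le_mul_of_nonneg_left (hu i) (softmax_nonneg _ _)
    _ ≤ b := by
        rw [← Finset.sum_mul]
        exact mul_le_of_le_one_left hb (sum_softmax_le_one _)

lemma abs_label_mul_weight_mul_le (hy : ∀ k, y k = 1 ∨ y k = -1) {b u z : ℝ} (hu : |u| ≤ b)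
    (k : Fin n) : |y k * logisticWeight z * u| ≤ b := by
  rw [abs_mul, abs_mul, abs_label hy, one_mul, abs_of_pos (logisticWeight_pos _)]
  exact (mul_le_of_le_one_left (abs_nonneg _) (logisticWeight_le_one _)).trans hu

lemma NearOrthogonal.abs_inner_gradCls_le (h : NearOrthogonal τ v E p) (hn : 0 < n)
    (hy : ∀ k, y k = 1 ∨ y k = -1) (q : Emb d) :
    |⟪gradCls X y v E p, q⟫| ≤ 4 * τ * ‖q‖ := by
  rw [inner_gradCls, abs_neg]
  have hτ := h.nonneg
  refine abs_average_le hn fun k => abs_label_mul_weight_mul_le hy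
    (abs_softmax_average_le (by positivity) fun i => ?_) k
  rw [abs_mul]
  have h1 : |⟪E (X k i), v⟫ - attn v E p (X k)| ≤ 2 * τ :=
    (abs_sub _ _).trans (by linarith [h.tok_dir (X k i), h.abs_attn_le (X k)])
  have h2 : |⟪E (X k i), q⟫| ≤ 2 * ‖q‖ := (abs_real_inner_le_norm _ _).trans
    (mul_le_mul_of_nonneg_right (h.norm_tok_le _) (norm_nonneg _))
  calc _ ≤ 2 * τ * (2 * ‖q‖) := mul_le_mul h1 h2 (abs_nonneg _) (by positivity)
    _ = _ := by ring

variable [DecidableEq S]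

lemma abs_stepCoeffDir_le_one (hn : 0 < n) (hy : ∀ k, y k = 1 ∨ y k = -1) (s : S) :
    |stepCoeffDir X y v E p s| ≤ 1 := by
  refine abs_average_le hn fun k => abs_label_mul_weight_mul_le hy ?_ k
  have h := abs_softmax_average_le (a := fun j => ⟪p, E (X k j)⟫)
    (u := fun i => if X k i = s then (1 : ℝ) else 0) zero_le_one
    (fun i => by split_ifs <;> norm_num)
  simpa only [mul_ite, mul_one, mul_zero] using h

lemma NearOrthogonal.abs_stepCoeffCls_le (h : NearOrthogonal τ v E p) (hn : 0 < n)
    (hy : ∀ k, y k = 1 ∨ y k = -1) (s : S) : |stepCoeffCls X y v E p s| ≤ 2 * τ := by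
  have hτ := h.nonneg
  refine abs_average_le hn fun k => abs_label_mul_weight_mul_le hy ?_ k
  have h := abs_softmax_average_le (a := fun j => ⟪p, E (X k j)⟫) (b := 2 * τ)
    (u := fun i => if X k i = s then ⟪E s, v⟫ - attn v E p (X k) else 0) (by positivity)
    (fun i => by
      split_ifs
      · exact (abs_sub _ _).trans (by linarith [h.tok_dir s, h.abs_attn_le (X k)])
      · rw [abs_zero]; positivity)
  simpa only [mul_ite, mul_zero] using h

/-- With logistic weight exactly `1/2` and attention exactly `1 / T` the coefficient would be
`signedFreq X y s / 2`. The two errors per position are at most `τ * (3 / T)` and `1/2 * (4 * τ /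
T)`, which add up to `5 * τ / T`. -/
lemma NearOrthogonal.abs_stepCoeffDir_sub_le (h : NearOrthogonal τ v E p) (hτ : 2 * τ ≤ 1)
    (hn : 0 < n) (hT : 0 < T) (hy : ∀ k, y k = 1 ∨ y k = -1) (s : S) :
    |stepCoeffDir X y v E p s - signedFreq X y s / 2| ≤ 5 * τ := by
  have hτ0 := h.nonneg
  have hT' : (0 : ℝ) < T := by exact_mod_cast hT
  have hn' : (0 : ℝ) < n := by exact_mod_cast hn
  have heq : stepCoeffDir X y v E p s - signedFreq X y s / 2 =
      1 / (n : ℝ) * ∑ k, y k * ∑ i, if X k i = s then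
        logisticWeight (y k * attn v E p (X k)) * attnWeight E p (X k) i - 1 / (2 * T) else 0 := by
    have h1 : signedFreq X y s / 2 =
        1 / (n : ℝ) * ∑ k, y k * ∑ i, if X k i = s then 1 / (2 * (T : ℝ)) else 0 := by
      have h2 : ∀ k, (∑ i, if X k i = s then 1 / (2 * (T : ℝ)) else 0) =
          1 / (2 * (T : ℝ)) * ∑ i, if X k i = s then (1 : ℝ) else 0 := fun k => by
        rw [Finset.mul_sum]
        simp only [mul_ite, mul_one, mul_zero]
      simp_rw [h2, mul_left_comm (y _), ← Finset.mul_sum]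
      rw [signedFreq]
      field_simp
    rw [h1, stepCoeffDir, ← mul_sub, ← Finset.sum_sub_distrib]
    congr 1
    refine Finset.sum_congr rfl fun k _ => ?_
    rw [mul_assoc, ← mul_sub, Finset.mul_sum, ← Finset.sum_sub_distrib]
    congr 1
    refine Finset.sum_congr rfl fun i _ => ?_
    split_ifs <;> simp
  rw [heq]
  refine abs_average_le hn fun k => ?_
  rw [abs_mul, abs_label hy, one_mul]
  refine (Finset.abs_sum_le_sum_abs _ _).trans ?_
  have hlog : ∀ j, |⟪p, E (X k j)⟫| ≤ τ := fun j => by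
    rw [real_inner_comm]; exact h.tok_cls _
  have hterm : ∀ i, |if X k i = s then
      logisticWeight (y k * attn v E p (X k)) * attnWeight E p (X k) i - 1 / (2 * T) else 0| ≤
      5 * τ / T := fun i => by
    split_ifs
    · have hz : |y k * attn v E p (X k)| ≤ τ := by
        rw [abs_mul, abs_label hy, one_mul]; exact h.abs_attn_le _
      have h1 := (abs_logisticWeight_sub_half_le (hz.trans (by linarith))).trans hz
      set g := logisticWeight (y k * attn v E p (X k))
      have h2 := le_softmax hlog i
      have h3 := softmax_le hlog hτ i
      have h0 := softmax_nonneg (fun j => ⟪p, E (X k j)⟫) i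
      set σ := attnWeight E p (X k) i with hσ
      have h4 : |σ - 1 / T| ≤ 4 * τ / T := by
        rw [abs_le]
        have h5 : (1 - 2 * τ) / T = 1 / T - 2 * τ / T := by ring
        have h6 : (1 + 4 * τ) / T = 1 / T + 4 * τ / T := by ring
        have h7 : 2 * τ / T ≤ 4 * τ / T := div_le_div_of_nonneg_right (by linarith) hT'.le
        constructor <;> linarith
      have h5 : σ ≤ 3 / T := h3.trans (div_le_div_of_nonneg_right (by linarith) hT'.le)
      have heq : g * σ - 1 / (2 * T) = (g - 1 / 2) * σ + 1 / 2 * (σ - 1 / T) := by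
        field_simp
        ring
      rw [heq]
      refine (abs_add_le _ _).trans ?_
      rw [abs_mul, abs_mul, abs_of_nonneg (by norm_num : (0 : ℝ) ≤ 1 / 2), abs_of_nonneg h0]
      calc |g - 1 / 2| * σ + 1 / 2 * |σ - 1 / T| ≤ τ * (3 / T) + 1 / 2 * (4 * τ / T) := by gcongr
        _ = 5 * τ / T := by ring
    · rw [abs_zero]; positivity
  refine (Finset.sum_le_sum fun i _ => hterm i).trans ?_
  rw [Finset.sum_const, Finset.card_univ, Fintype.card_fin, nsmul_eq_mul,
    mul_div_cancel₀ _ hT'.ne']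

lemma inner_stepTok (s : S) (q : Emb d) :
    ⟪q, stepTok X y v η E p s⟫ = ⟪q, E s⟫ +
      η * (stepCoeffDir X y v E p s * ⟪q, v⟫ + stepCoeffCls X y v E p s * ⟪q, p⟫) := by
  rw [stepTok_eq, inner_add_right, real_inner_smul_right, inner_add_right, real_inner_smul_right,
    real_inner_smul_right]

/-- After one step, the component of a token along `v` is governed by its signed frequency. -/
lemma NearOrthogonal.abs_inner_stepTok_sub_le (h : NearOrthogonal τ v E p) (hv : ‖v‖ = 1)
    (hτ : 2 * τ ≤ 1) (hη : 1 ≤ η) (hn : 0 < n) (hT : 0 < T) (hy : ∀ k, y k = 1 ∨ y k = -1)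
    (s : S) : |⟪stepTok X y v η E p s, v⟫ - η / 2 * signedFreq X y s| ≤ 8 * η * τ := by
  rw [real_inner_comm, inner_stepTok, real_inner_self_eq_norm_sq, hv]
  have hτ0 := h.nonneg
  have h1 := h.abs_stepCoeffDir_sub_le (X := X) hτ hn hT hy s
  have h2 := h.abs_stepCoeffCls_le (X := X) hn hy s
  have h3 := h.tok_dir s
  have h4 := h.cls_dir
  rw [real_inner_comm] at h3 h4
  set β := stepCoeffDir X y v E p s
  set κ := stepCoeffCls X y v E p s
  have h5 : |κ * ⟪v, p⟫| ≤ 2 * τ := by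
    rw [abs_mul]
    calc |κ| * |⟪v, p⟫| ≤ 2 * τ * 1 :=
          mul_le_mul h2 (h4.trans (by linarith)) (abs_nonneg _) (by positivity)
      _ = _ := mul_one _
  have heq : ⟪v, E s⟫ + η * (β * 1 ^ 2 + κ * ⟪v, p⟫) - η / 2 * signedFreq X y s =
      ⟪v, E s⟫ + η * ((β - signedFreq X y s / 2) + κ * ⟪v, p⟫) := by ring
  rw [heq]
  refine (abs_add_le _ _).trans ?_
  rw [abs_mul, abs_of_nonneg (by linarith : 0 ≤ η)]
  have h6 := (abs_add_le (β - signedFreq X y s / 2) (κ * ⟪v, p⟫)).trans (add_le_add h1 h5)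
  nlinarith [mul_le_mul_of_nonneg_left h6 (by linarith : 0 ≤ η)]

/-- After one step, all the attention scores are small. -/
lemma NearOrthogonal.abs_inner_step_le (h : NearOrthogonal τ v E p) (hv : ‖v‖ = 1)
    (hτ : 2 * τ ≤ 1) (hη : 1 ≤ η) (hn : 0 < n) (hy : ∀ k, y k = 1 ∨ y k = -1) (s : S) :
    |⟪stepCls X y v η E p, stepTok X y v η E p s⟫| ≤ 26 * η ^ 2 * τ := by
  have hτ0 := h.nonneg
  have h1 := abs_stepCoeffDir_le_one (X := X) (v := v) (E := E) (p := p) hn hy s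
  have h2 := h.abs_stepCoeffCls_le (X := X) hn hy s
  have h3 := h.abs_inner_gradCls_le (X := X) hn hy (stepTok X y v η E p s)
  have hnorm : ‖stepTok X y v η E p s‖ ≤ 5 * η := by
    rw [stepTok_eq]
    have h4 : ‖stepCoeffDir X y v E p s • v + stepCoeffCls X y v E p s • p‖ ≤ 3 := by
      refine (norm_add_le _ _).trans ?_
      rw [norm_smul, norm_smul, hv, Real.norm_eq_abs, Real.norm_eq_abs]
      have : |stepCoeffCls X y v E p s| * ‖p‖ ≤ 1 * 2 :=
        mul_le_mul (h2.trans hτ) h.norm_cls_le (norm_nonneg _) zero_le_one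
      linarith
    refine (norm_add_le _ _).trans ?_
    rw [norm_smul, Real.norm_of_nonneg (by linarith : 0 ≤ η)]
    nlinarith [h.norm_tok_le s, mul_le_mul_of_nonneg_left h4 (by linarith : 0 ≤ η)]
  rw [stepCls, inner_sub_left, real_inner_smul_left, inner_stepTok]
  have h5 : |⟪p, E s⟫| ≤ τ := by rw [real_inner_comm]; exact h.tok_cls s
  have h6 : |stepCoeffDir X y v E p s * ⟪p, v⟫ + stepCoeffCls X y v E p s * ⟪p, p⟫| ≤ 5 * τ := by
    refine (abs_add_le _ _).trans ?_
    rw [abs_mul, abs_mul, real_inner_self_eq_norm_sq, abs_of_nonneg (sq_nonneg ‖p‖)]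
    have h7 : |stepCoeffDir X y v E p s| * |⟪p, v⟫| ≤ 1 * τ :=
      mul_le_mul h1 h.cls_dir (abs_nonneg _) zero_le_one
    have h8 : |stepCoeffCls X y v E p s| * ‖p‖ ^ 2 ≤ 2 * τ * 2 :=
      mul_le_mul h2 h.cls_le (sq_nonneg _) (by positivity)
    linarith
  refine (abs_sub _ _).trans ?_
  have h7 := abs_add_le ⟪p, E s⟫
    (η * (stepCoeffDir X y v E p s * ⟪p, v⟫ + stepCoeffCls X y v E p s * ⟪p, p⟫))
  rw [abs_mul, abs_of_nonneg (by linarith : 0 ≤ η)] at h7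
  rw [abs_mul, abs_of_nonneg (by linarith : 0 ≤ η)]
  have h8 := mul_le_mul_of_nonneg_left h6 (by linarith : 0 ≤ η)
  have h9 : η * |⟪gradCls X y v E p, stepTok X y v η E p s⟫| ≤ η * (4 * τ * (5 * η)) :=
    mul_le_mul_of_nonneg_left (h3.trans (mul_le_mul_of_nonneg_left hnorm (by positivity)))
      (by linarith)
  have h10 : η * τ ≤ η ^ 2 * τ := mul_le_mul_of_nonneg_right (by nlinarith) hτ0
  have h11 : τ ≤ η * τ := le_mul_of_one_le_left hτ0 hη
  linarith

/-- After one step, a direction separates the completely positive or negative tokens from the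
other ones. -/
lemma NearOrthogonal.exists_separating [Fintype S] (h : NearOrthogonal τ v E p)
    (hη : 1 ≤ η) (hcard : (Fintype.card S : ℝ) ≤ η) (hsmall : 24 * η ^ 2 * τ ≤ 1) (hτ : 2 * τ ≤ 1)
    (hn : 0 < n) (hy : ∀ k, y k = 1 ∨ y k = -1) :
    ∃ w : Emb d, ∀ s ∈ completeTokens X y, ∀ s' ∉ completeTokens X y,
      1 / 4 ≤ ⟪w, stepTok X y v η E p s - stepTok X y v η E p s'⟫ := by
  classical
  have hτ0 := h.nonneg
  have hητ : 0 ≤ η * τ := by positivity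
  set A : Finset S := Finset.univ.filter (· ∈ completeTokens X y) with hA
  have hsum : ∀ (B : Finset S) (u : Emb d), (∀ s ∈ B, |⟪E s, u⟫| ≤ τ) →
      |∑ s ∈ B, ⟪E s, u⟫| ≤ η * τ := fun B u hu => by
    refine (Finset.abs_sum_le_sum_abs _ _).trans ((Finset.sum_le_sum hu).trans ?_)
    rw [Finset.sum_const, nsmul_eq_mul]
    refine mul_le_mul_of_nonneg_right (le_trans ?_ hcard) hτ0
    exact_mod_cast Finset.card_le_univ B
  -- The witness is the sum of the initial embeddings of all complete tokens. Near orthogonality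
  -- gives a gap of at least `1/2 - 2 * η * τ` before the step; the step costs at most `4 * η ^ 2 *
  -- τ`, and `24 * η ^ 2 * τ ≤ 1` leaves `1/4`.
  refine ⟨∑ s ∈ A, E s, fun s hs s' hs' => ?_⟩
  have hv' : |⟪∑ s ∈ A, E s, v⟫| ≤ η * τ := by
    rw [sum_inner]; exact hsum A v fun s _ => h.tok_dir s
  have hp' : |⟪∑ s ∈ A, E s, p⟫| ≤ η * τ := by
    rw [sum_inner]; exact hsum A p fun s _ => h.tok_cls s
  have hE' : |⟪∑ s ∈ A, E s, E s'⟫| ≤ η * τ := by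
    rw [sum_inner]
    refine hsum A (E s') fun t ht => h.tok_tok t s' ?_
    rintro rfl
    exact hs' (Finset.mem_filter.1 ht).2
  have hE : 1 / 2 - η * τ ≤ ⟪∑ s ∈ A, E s, E s⟫ := by
    have hsA : s ∈ A := Finset.mem_filter.2 ⟨Finset.mem_univ s, hs⟩
    rw [sum_inner, ← Finset.add_sum_erase A _ hsA, real_inner_self_eq_norm_sq]
    have := hsum (A.erase s) (E s) fun t ht => h.tok_tok t s (Finset.ne_of_mem_erase ht)
    linarith [h.half_le_tok s, neg_abs_le (∑ t ∈ A.erase s, ⟪E t, E s⟫)]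
  set w := ∑ s ∈ A, E s
  have hpert : ∀ t, |stepCoeffDir X y v E p t * ⟪w, v⟫ + stepCoeffCls X y v E p t * ⟪w, p⟫| ≤
      2 * (η * τ) := fun t => by
    refine (abs_add_le _ _).trans ?_
    rw [abs_mul, abs_mul]
    have h7 : |stepCoeffDir X y v E p t| * |⟪w, v⟫| ≤ 1 * (η * τ) :=
      mul_le_mul (abs_stepCoeffDir_le_one hn hy t) hv' (abs_nonneg _) zero_le_one
    have h8 : |stepCoeffCls X y v E p t| * |⟪w, p⟫| ≤ 1 * (η * τ) :=
      mul_le_mul ((h.abs_stepCoeffCls_le hn hy t).trans hτ) hp' (abs_nonneg _) zero_le_one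
    linarith
  rw [inner_sub_right, inner_stepTok, inner_stepTok]
  have hη0 : 0 ≤ η := by linarith
  have h1 := mul_le_mul_of_nonneg_left (neg_le_of_abs_le (hpert s)) hη0
  have h2 := mul_le_mul_of_nonneg_left (le_of_abs_le (hpert s')) hη0
  have h3 := le_of_abs_le hE'
  have h4 : η * τ ≤ η ^ 2 * τ := mul_le_mul_of_nonneg_right (by nlinarith) hτ0
  linarith

end FirstStep

/-! ### Confidence after the first step and the deterministic theorem -/

section Step

variable {S : Type*} [DecidableEq S] {n T d : ℕ} {X : Fin n → Fin T → S} {y : Fin n → ℝ}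
  {v : Emb d} {E : S → Emb d} {p : Emb d} {τ η : ℝ}

/-- After one step, the output of the model is large and has the sign of the label. -/
lemma NearOrthogonal.le_label_mul_attn_step (h : NearOrthogonal τ v E p) (hv : ‖v‖ = 1)
    (hτ : 2 * τ ≤ 1) (hy : ∀ k, y k = 1 ∨ y k = -1)
    (hη : 4 * (n : ℝ) ^ 2 * (T : ℝ) ^ 2 ≤ η) (hη1 : 1 ≤ η) (hsmall : 224 * η ^ 3 * τ ≤ 1)
    {k : Fin n} {s : S} (hs : Appears (X k) s) (hsc : s ∈ completeTokens X y)
    (hirr : ∀ s', Appears (X k) s' → s' ≠ s → Irrelevant X y s') :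
    2 * (n : ℝ) - 1 / 2 ≤
      y k * attn v (stepTok X y v η E p) (stepCls X y v η E p) (X k) := by
  have hτ0 := h.nonneg
  have hn := k.pos
  obtain ⟨i₀, hi₀⟩ := id hs
  have hT := i₀.pos
  have hn' : (1 : ℝ) ≤ n := by exact_mod_cast hn
  have hT' : (1 : ℝ) ≤ T := by exact_mod_cast hT
  set E1 := stepTok X y v η E p
  set p1 := stepCls X y v η E p
  have hγ : ∀ s, |⟪E1 s, v⟫ - η / 2 * signedFreq X y s| ≤ 8 * η * τ :=
    h.abs_inner_stepTok_sub_le hv hτ hη1 hn hT hy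
  have hyγ : ∀ s, |y k * ⟪E1 s, v⟫ - η / 2 * (y k * signedFreq X y s)| ≤ 8 * η * τ := fun s => by
    have : y k * ⟪E1 s, v⟫ - η / 2 * (y k * signedFreq X y s) =
        y k * (⟪E1 s, v⟫ - η / 2 * signedFreq X y s) := by ring
    rw [this, abs_mul, abs_label hy, one_mul]
    exact hγ s
  have hbig : 2 * (n : ℝ) * T ≤ y k * ⟪E1 s, v⟫ + 8 * η * τ := by
    have h1 := neg_le_of_abs_le (hyγ s)
    have h2 := mul_le_mul_of_nonneg_left (inv_le_label_mul_signedFreq hsc hs)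
      (by linarith : 0 ≤ η / 2)
    -- This is where `4 n² T² ≤ η` enters. The factor `T` offsets the attention of about `1 / T` on
    -- the complete token, leaving an output of about `2 * n`.
    have h3 : 2 * (n : ℝ) * T ≤ η / 2 * (1 / (n * T)) := by
      rw [mul_one_div, le_div_iff₀ (by positivity)]
      nlinarith
    linarith
  have hlow : ∀ i, 0 ≤ y k * ⟪E1 (X k i), v⟫ + 8 * η * τ := fun i => by
    by_cases hi : X k i = s
    · rw [hi]; exact le_trans (by positivity) hbig
    · have h1 := neg_le_of_abs_le (hyγ (X k i))
      rw [hirr _ ⟨i, rfl⟩ hi] at h1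
      linarith
  have hσ := le_softmax (a := fun j => ⟪p1, E1 (X k j)⟫)
    (fun j => h.abs_inner_step_le hv hτ hη1 hn hy (X k j)) i₀
  -- Shifting the values by `8 * η * τ` makes every term nonnegative, so only one occurrence of `s`
  -- need be kept. The total error is at most `112 * η ^ 3 * τ ≤ 1/2`, hence the constant `224`.
  have heq : y k * attn v E1 p1 (X k) =
      ∑ i, attnWeight E1 p1 (X k) i * (y k * ⟪E1 (X k i), v⟫ + 8 * η * τ) - 8 * η * τ := by
    simp_rw [mul_add, Finset.sum_add_distrib, ← Finset.sum_mul]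
    rw [sum_softmax _ i₀, attn, Finset.mul_sum]
    simp_rw [mul_left_comm (y k)]
    ring
  have hsingle := Finset.single_le_sum
    (f := fun i => attnWeight E1 p1 (X k) i * (y k * ⟪E1 (X k i), v⟫ + 8 * η * τ))
    (fun i _ => mul_nonneg (softmax_nonneg _ _) (hlow i)) (Finset.mem_univ i₀)
  have hησ : 0 ≤ η ^ 2 * τ := by positivity
  have hnη : (n : ℝ) ≤ η := by nlinarith [mul_le_mul hn' hT' zero_le_one (by linarith)]
  have hpos : 0 ≤ 1 - 2 * (26 * η ^ 2 * τ) := by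
    have : η ^ 2 * τ ≤ η ^ 3 * τ := mul_le_mul_of_nonneg_right (by nlinarith [sq_nonneg η]) hτ0
    linarith
  have h1 : (1 - 2 * (26 * η ^ 2 * τ)) / T * (2 * n * T) ≤
      attnWeight E1 p1 (X k) i₀ * (y k * ⟪E1 (X k i₀), v⟫ + 8 * η * τ) := by
    refine mul_le_mul hσ (by rw [hi₀]; exact hbig) (by positivity) (softmax_nonneg _ _)
  have h2 : (1 - 2 * (26 * η ^ 2 * τ)) / T * (2 * n * T) =
      2 * n - 104 * (n * (η ^ 2 * τ)) := by
    field_simp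
    ring
  have h3 : n * (η ^ 2 * τ) ≤ η ^ 3 * τ := by
    calc n * (η ^ 2 * τ) ≤ η * (η ^ 2 * τ) := mul_le_mul_of_nonneg_right hnη hησ
      _ = _ := by ring
  have h4 : η * τ ≤ η ^ 3 * τ :=
    mul_le_mul_of_nonneg_right (by nlinarith [sq_nonneg η, mul_le_mul hη1 hη1]) hτ0
  rw [heq]
  linarith

/-- Converts a margin of `2 * n - 1/2` in all `n` sequences into the loss threshold for confidence.
With `n ≤ exp (n - 1)` it reduces to `u ^ 3 ≤ u / (1 + u)` for `u = exp (-1/2) ≤ 2/3`. -/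
lemma nat_mul_exp_le_log {n : ℕ} (hn : 0 < n) :
    n * Real.exp (-(2 * (n : ℝ) - 1 / 2)) ≤ Real.log (1 + Real.exp (-(1 / 2))) := by
  have hn' : (1 : ℝ) ≤ n := by exact_mod_cast hn
  have h1 : (n : ℝ) ≤ Real.exp (n - 1) := by linarith [Real.add_one_le_exp ((n : ℝ) - 1)]
  have h2 : n * Real.exp (-(2 * (n : ℝ) - 1 / 2)) ≤ Real.exp (-(3 / 2)) := by
    refine (mul_le_mul_of_nonneg_right h1 (Real.exp_pos _).le).trans ?_
    rw [← Real.exp_add, Real.exp_le_exp]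
    linarith
  have h3 := Real.one_sub_inv_le_log_of_pos (by positivity : 0 < 1 + Real.exp (-(1 / 2)))
  refine h2.trans (le_trans ?_ h3)
  set u := Real.exp (-(1 / 2)) with hu
  have hu0 : 0 < u := Real.exp_pos _
  have hu1 : u * (3 / 2) ≤ 1 := by
    have h4 : (3 / 2 : ℝ) ≤ Real.exp (1 / 2) := by linarith [Real.add_one_le_exp (1 / 2 : ℝ)]
    calc u * (3 / 2) ≤ u * Real.exp (1 / 2) := mul_le_mul_of_nonneg_left h4 hu0.le
      _ = 1 := by rw [hu, ← Real.exp_add]; norm_num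
  have hu3 : Real.exp (-(3 / 2)) = u ^ 3 := by
    rw [hu, ← Real.exp_nat_mul]; norm_num
  have h5 : 1 - (1 + u)⁻¹ = u / (1 + u) := by field_simp; ring
  rw [hu3, h5, le_div_iff₀ (by positivity)]
  nlinarith [mul_pos hu0 hu0, mul_pos (mul_pos hu0 hu0) hu0]

/-- The behaviour of the gradient flow after one step from a nearly orthogonal initialization. -/
theorem NearOrthogonal.flow_limit [Fintype S] (h : NearOrthogonal τ v E p) (hv : ‖v‖ = 1)
    (hy : ∀ k, y k = 1 ∨ y k = -1) (hvocab : ∀ s : S, ∃ k, Appears (X k) s)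
    (hdata : SingleCompleteToken X y) (hirr : ∃ s : S, Irrelevant X y s)
    (hη : 4 * (n : ℝ) ^ 2 * (T : ℝ) ^ 2 ≤ η) (hsmall : 224 * η ^ 3 * τ ≤ 1) {P : ℝ → Emb d}
    (hP : IsGradientFlow X y v (stepTok X y v η E p) (stepCls X y v η E p) P) :
    Tendsto (fun t => ‖P t‖) atTop atTop ∧
      ∀ pinf : Emb d, Tendsto (fun t => (‖P t‖)⁻¹ • P t) atTop (𝓝 pinf) →
        completeTokens X y ⊆ ⋃ k, selected (stepTok X y v η E p) (X k) pinf ∧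
        maxMarginDirections (stepTok X y v η E p) X pinf = {pinf} := by
  choose c hc hcc hcirr using hdata
  have hcc' : ∀ k, c k ∈ completeTokens X y := hcc
  obtain ⟨s₀, hs₀⟩ := hirr
  obtain ⟨k₀, i₀, hi₀⟩ := hvocab s₀
  have hτ0 := h.nonneg
  have hn := k₀.pos
  have hT := i₀.pos
  have hn' : (1 : ℝ) ≤ n := by exact_mod_cast hn
  have hT' : (1 : ℝ) ≤ T := by exact_mod_cast hT
  have hnT : (1 : ℝ) ≤ n * T := by nlinarith
  have hnTη : (n : ℝ) * T ≤ η := by nlinarith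
  have hη1 : 1 ≤ η := hnT.trans hnTη
  have h23 : η ^ 2 * τ ≤ η ^ 3 * τ := mul_le_mul_of_nonneg_right (by nlinarith [sq_nonneg η]) hτ0
  have h12 : η * τ ≤ η ^ 2 * τ := mul_le_mul_of_nonneg_right (by nlinarith) hτ0
  have h01 : τ ≤ η * τ := le_mul_of_one_le_left hτ0 hη1
  have hτ : 2 * τ ≤ 1 := by linarith
  have hirr1 : ∀ k i, X k i ≠ c k → Irrelevant X y (X k i) :=
    fun k i hi => hcirr k _ ⟨i, rfl⟩ hi
  set E1 := stepTok X y v η E p with hE1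
  have hirr2 : ∀ k i, X k i ≠ c k → y k * ⟪E1 (X k i), v⟫ ≤ 1 / 4 := fun k i hi => by
    have h1 := h.abs_inner_stepTok_sub_le hv hτ hη1 hn hT hy (X := X) (X k i)
    rw [hirr1 k i hi, mul_zero, sub_zero] at h1
    refine (le_abs_self _).trans ?_
    rw [abs_mul, abs_label hy, one_mul]
    linarith
  have hloss : n * loss X y v E1 (stepCls X y v η E p) ≤
      Real.log (1 + Real.exp (-(1 / 2))) := by
    refine le_trans ?_ (nat_mul_exp_le_log hn)
    have hn0 : (n : ℝ) ≠ 0 := by positivity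
    rw [loss, ← mul_assoc, mul_one_div_cancel hn0, one_mul]
    refine (Finset.sum_le_sum (g := fun _ => Real.exp (-(2 * (n : ℝ) - 1 / 2)))
      fun k _ => ?_).trans (by simp)
    have h1 := h.le_label_mul_attn_step hv hτ hy hη hη1 hsmall (hc k) (hcc' k) (hcirr k)
    have h2 := Real.log_le_sub_one_of_pos (x := 1 + Real.exp (-(y k * attn v E1
      (stepCls X y v η E p) (X k)))) (by positivity)
    rw [add_sub_cancel_left] at h2
    exact h2.trans (Real.exp_le_exp.2 (neg_le_neg h1))
  have hconf : ∀ t, 0 ≤ t → Confident X y v E1 (P t) := fun t ht =>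
    confident_of_loss_le hn
      ((mul_le_mul_of_nonneg_left (hP.loss_le ht) (by positivity)).trans hloss)
  obtain ⟨w, hw⟩ := h.exists_separating (X := X) hη1 ((card_vocab_le hvocab).trans hnTη)
    (by linarith) hτ hn hy
  -- Complete tokens have nonzero signed frequency, so within a sequence `c k` is the only complete
  -- token; selecting each `c k` therefore selects all of `completeTokens X y`.
  have hnot : ∀ k i, X k i ≠ c k → X k i ∉ completeTokens X y := fun k i hi hmem =>
    not_irrelevant_of_complete hmem ⟨i, rfl⟩ (hirr1 k i hi)
  have hnorm := hP.tendsto_norm_atTop hy hc hirr2 hconf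
    (fun k i hi => hw _ (hcc' k) _ (hnot k i hi))
    ⟨k₀, i₀, fun heq => not_irrelevant_of_complete (hcc' k₀) (hc k₀) (by rwa [← heq, hi₀])⟩
  refine ⟨hnorm, fun pinf hlim => ⟨fun s hs => ?_,
    hP.maxMarginDirections_eq hy hc hirr2 hconf hnorm hlim⟩⟩
  obtain ⟨k, i, rfl⟩ := hvocab s
  have heq : X k i = c k := by
    by_contra hne
    exact hnot k i hne hs
  rw [heq]
  exact Set.mem_iUnion.2 ⟨k, mem_selected_direction hy hc hirr2 hconf hnorm hlim k⟩

end Step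

/-! ### Concentration of isotropic Gaussian vectors -/

section Concentration

variable {d : ℕ}

/-- The law `N(0, (1/d) I)`. -/
noncomputable abbrev isoGaussian (d : ℕ) : Measure (Emb d) :=
  multivariateGaussian 0 ((1 / (d : ℝ)) • (1 : Matrix (Fin d) (Fin d) ℝ))

lemma posSemidef_smul_one (d : ℕ) : ((1 / (d : ℝ)) • (1 : Matrix (Fin d) (Fin d) ℝ)).PosSemidef :=
  Matrix.PosSemidef.one.smul (by positivity)

lemma map_inner_isoGaussian (u : Emb d) :
    (isoGaussian d).map (fun x => ⟪x, u⟫) = gaussianReal 0 (‖u‖ ^ 2 / d).toNNReal := by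
  have h := IsGaussian.map_eq_gaussianReal (μ := isoGaussian d) (innerSL ℝ u)
  have hfun : (fun x => ⟪x, u⟫) = ⇑(innerSL ℝ u) := by
    ext x
    rw [innerSL_apply_apply, real_inner_comm]
  have hvar : Var[⇑(innerSL ℝ u); isoGaussian d] = ‖u‖ ^ 2 / d := by
    have h1 := covarianceBilin_self (μ := isoGaussian d) IsGaussian.memLp_two_id u
    rw [covarianceBilin_multivariateGaussian (posSemidef_smul_one d)] at h1
    refine h1.symm.trans ?_
    rw [Matrix.smul_mulVec, Matrix.one_mulVec, dotProduct_smul, EuclideanSpace.real_norm_sq_eq]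
    simp only [dotProduct, smul_eq_mul, sq]
    ring
  have hmean : ∫ x, (innerSL ℝ u) x ∂(isoGaussian d) = 0 := by
    rw [ContinuousLinearMap.integral_comp_id_comm IsGaussian.integrable_id]
    simp
  rw [hfun, h, hvar, hmean]

lemma isoGaussian_abs_inner_le (hd : 0 < d) {u : Emb d} (hu : ‖u‖ ^ 2 ≤ 2) {τ : ℝ} (hτ : 0 ≤ τ) :
    (isoGaussian d).real {x | τ < |⟪x, u⟫|} ≤ 2 * Real.exp (-(τ ^ 2 * d / 4)) := by
  have hd' : (0 : ℝ) < d := by exact_mod_cast hd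
  -- The projection has variance `‖u‖ ^ 2 / d ≤ 2 / d`, which explains the exponent `τ ^ 2 * d / 4`.
  have hsub : HasSubgaussianMGF (fun x : Emb d => ⟪x, u⟫) (2 / d : NNReal) (isoGaussian d) := by
    have hm : Measurable fun x : Emb d => ⟪x, u⟫ := by fun_prop
    refine ⟨fun t => ?_, fun t => ?_⟩
    · have := integrable_exp_mul_gaussianReal (μ := 0) (v := (‖u‖ ^ 2 / d).toNNReal) t
      rw [← map_inner_isoGaussian, integrable_map_measure (by fun_prop) hm.aemeasurable] at this
      exact this
    · rw [mgf_gaussianReal (map_inner_isoGaussian u), Real.exp_le_exp,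
        Real.coe_toNNReal _ (by positivity)]
      push_cast
      rw [zero_mul, zero_add]
      gcongr
  have h1 := hsub.measure_ge_le hτ
  have h2 := hsub.neg.measure_ge_le hτ
  have hexp : -τ ^ 2 / (2 * ((2 / d : NNReal) : ℝ)) = -(τ ^ 2 * d / 4) := by
    push_cast
    field_simp
    norm_num
  rw [hexp] at h1 h2
  have hcov : {x : Emb d | τ < |⟪x, u⟫|} ⊆ {x | τ ≤ ⟪x, u⟫} ∪ {x | τ ≤ (-fun x => ⟪x, u⟫) x} := by
    intro x hx
    rcases lt_abs.1 (show τ < |⟪x, u⟫| from hx) with h | h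
    · exact Or.inl h.le
    · exact Or.inr h.le
  refine (measureReal_mono hcov).trans ((measureReal_union_le _ _).trans ?_)
  linarith

/-- By independence and Fubini, `B` can be frozen at a value `u` with `‖u‖ ^ 2 ≤ 2`, which reduces
to a fixed vector. Larger norms are excluded from the event and are counted separately. -/
lemma measureReal_abs_inner_le {Ω : Type*} [MeasurableSpace Ω] {ρ : Measure Ω}
    [IsProbabilityMeasure ρ] (hd : 0 < d) {A B : Ω → Emb d} (hA : Measurable A) (hB : Measurable B)
    (hind : IndepFun A B ρ) (hlaw : ρ.map A = isoGaussian d) {τ : ℝ} (hτ : 0 ≤ τ) :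
    ρ.real {ω | τ < |⟪A ω, B ω⟫| ∧ ‖B ω‖ ^ 2 ≤ 2} ≤ 2 * Real.exp (-(τ ^ 2 * d / 4)) := by
  set s : Set (Emb d × Emb d) := {z | τ < |⟪z.1, z.2⟫| ∧ ‖z.2‖ ^ 2 ≤ 2} with hs
  have hsm : MeasurableSet s := by
    have h1 : Measurable fun z : Emb d × Emb d => |⟪z.1, z.2⟫| := by fun_prop
    have h2 : Measurable fun z : Emb d × Emb d => ‖z.2‖ ^ 2 := by fun_prop
    exact (measurableSet_lt measurable_const h1).inter (measurableSet_le h2 measurable_const)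
  have hprob : IsProbabilityMeasure (ρ.map B) := Measure.isProbabilityMeasure_map hB.aemeasurable
  have hpre : {ω | τ < |⟪A ω, B ω⟫| ∧ ‖B ω‖ ^ 2 ≤ 2} = (fun ω => (A ω, B ω)) ⁻¹' s := rfl
  rw [measureReal_def, hpre, ← Measure.map_apply (hA.prodMk hB) hsm,
    hind.map_prod_eq_prod_map_map hA.aemeasurable hB.aemeasurable, hlaw,
    Measure.prod_apply_symm hsm]
  refine ENNReal.toReal_le_of_le_ofReal (by positivity) ?_
  refine (lintegral_mono (g := fun _ => ENNReal.ofReal (2 * Real.exp (-(τ ^ 2 * d / 4))))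
    fun u => ?_).trans (by simp)
  by_cases hu : ‖u‖ ^ 2 ≤ 2
  · have heq : (fun x => (x, u)) ⁻¹' s = {x | τ < |⟪x, u⟫|} := by
      ext x
      simp [hs, hu]
    rw [heq, ← ENNReal.ofReal_toReal (measure_ne_top (isoGaussian d) _)]
    exact ENNReal.ofReal_le_ofReal (isoGaussian_abs_inner_le hd hu hτ)
  · have heq : (fun x => (x, u)) ⁻¹' s = ∅ := by
      ext x
      simp [hs, hu]
    rw [heq, measure_empty]
    exact zero_le

/-- Independent standard coordinates make `d * ‖x‖ ^ 2` a sum of squares whose moment generating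
function factors. -/
lemma isoGaussian_eq_map (d : ℕ) :
    isoGaussian d = (Measure.pi fun _ : Fin d => gaussianReal 0 1).map
      (fun x => (√(d : ℝ))⁻¹ • WithLp.toLp 2 x) := by
  have hcomp : (fun x : Fin d → ℝ => (√(d : ℝ))⁻¹ • WithLp.toLp 2 x) =
      (fun z : Emb d => (√(d : ℝ))⁻¹ • z) ∘ WithLp.toLp 2 := rfl
  rw [hcomp, ← Measure.map_map (by fun_prop) (by fun_prop), map_pi_eq_stdGaussian]
  refine Measure.ext_of_charFun ?_
  ext t
  rw [charFun_multivariateGaussian (posSemidef_smul_one d), charFun_map_smul,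
    charFun_stdGaussian, norm_smul, ← Complex.ofReal_pow, mul_pow, Matrix.smul_mulVec, Matrix.one_mulVec,
    dotProduct_smul, EuclideanSpace.real_norm_sq_eq]
  have h1 : ‖(√(d : ℝ))⁻¹‖ ^ 2 = 1 / d := by
    rw [Real.norm_of_nonneg (by positivity), inv_pow, Real.sq_sqrt (by positivity), one_div]
  rw [h1]
  congr 1
  simp only [dotProduct, smul_eq_mul, sq, inner_zero_right]
  push_cast
  ring

lemma mgf_sq_gaussianReal {t : ℝ} (ht : t < 1 / 2) :
    Integrable (fun x => Real.exp (t * x ^ 2)) (gaussianReal 0 1) ∧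
      ∫ x, Real.exp (t * x ^ 2) ∂(gaussianReal 0 1) = (√(1 - 2 * t))⁻¹ := by
  have hb : 0 < 1 / 2 - t := by linarith
  have hprod : (fun x => gaussianPDFReal 0 1 x • Real.exp (t * x ^ 2)) =
      fun x => (√(2 * Real.pi))⁻¹ * Real.exp (-(1 / 2 - t) * x ^ 2) := by
    ext x
    rw [gaussianPDFReal, smul_eq_mul, mul_assoc, ← Real.exp_add]
    norm_num
    ring_nf
    simp
  constructor
  · rw [gaussianReal_of_var_ne_zero 0 one_ne_zero, gaussianPDF_def]
    rw [integrable_withDensity_iff_integrable_smul' (by fun_prop)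
      (Eventually.of_forall fun x => ENNReal.ofReal_lt_top)]
    simp only [ENNReal.toReal_ofReal (gaussianPDFReal_nonneg _ _ _)]
    rw [hprod]
    exact (integrable_exp_neg_mul_sq hb).const_mul _
  · rw [integral_gaussianReal_eq_integral_smul one_ne_zero, hprod, integral_const_mul,
      integral_gaussian, ← Real.sqrt_inv, ← Real.sqrt_inv, ← Real.sqrt_mul (by positivity)]
    congr 1
    have : 1 - 2 * t ≠ 0 := by linarith
    have hpi := Real.pi_ne_zero
    have hb' := hb.ne'
    field_simp

lemma mgf_sum_sq_gaussianReal {t : ℝ} (ht : t < 1 / 2) :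
    Integrable (fun x : Fin d → ℝ => Real.exp (t * ∑ i, x i ^ 2))
        (Measure.pi fun _ : Fin d => gaussianReal 0 1) ∧
      mgf (fun x : Fin d → ℝ => ∑ i, x i ^ 2) (Measure.pi fun _ : Fin d => gaussianReal 0 1) t =
        (√(1 - 2 * t))⁻¹ ^ d := by
  have hprod : (fun x : Fin d → ℝ => Real.exp (t * ∑ i, x i ^ 2)) =
      fun x => ∏ i, Real.exp (t * x i ^ 2) := by
    ext x
    rw [Finset.mul_sum, Real.exp_sum]
  refine ⟨?_, ?_⟩
  · rw [hprod]
    exact Integrable.fintype_prod fun _ => (mgf_sq_gaussianReal ht).1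
  · rw [mgf, hprod, integral_fintype_prod_eq_pow (fun x => Real.exp (t * x ^ 2)),
      (mgf_sq_gaussianReal ht).2, Fintype.card_fin]

lemma isoGaussian_norm_sq_concentration (hd : 0 < d) :
    (isoGaussian d).real {x | ‖x‖ ^ 2 < 1 / 2} ≤ Real.exp (-((d : ℝ) / 16)) ∧
      (isoGaussian d).real {x | 2 < ‖x‖ ^ 2} ≤ Real.exp (-((d : ℝ) / 16)) := by
  have hd' : (0 : ℝ) < d := by exact_mod_cast hd
  have hnorm : ∀ x : Fin d → ℝ, ‖(√(d : ℝ))⁻¹ • WithLp.toLp 2 x‖ ^ 2 = (∑ i, x i ^ 2) / d := by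
    intro x
    rw [norm_smul, mul_pow, EuclideanSpace.real_norm_sq_eq, Real.norm_of_nonneg (by positivity),
      inv_pow, Real.sq_sqrt hd'.le, inv_mul_eq_div]
  have hmeas : Measurable fun x : Fin d → ℝ => (√(d : ℝ))⁻¹ • WithLp.toLp 2 x := by fun_prop
  have hlog := Real.log_two_lt_d9
  have hlog' := Real.log_two_gt_d9
  have hsqrt : √2 = Real.exp (Real.log 2 / 2) := by
    rw [Real.sqrt_eq_rpow, Real.rpow_def_of_pos two_pos]
    ring_nf
  constructor
  · rw [isoGaussian_eq_map, map_measureReal_apply hmeas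
      (measurableSet_lt (by fun_prop) measurable_const)]
    have hsub : (fun x : Fin d → ℝ => (√(d : ℝ))⁻¹ • WithLp.toLp 2 x) ⁻¹' {x | ‖x‖ ^ 2 < 1 / 2} ⊆
        {x | ∑ i, x i ^ 2 ≤ (d : ℝ) / 2} := fun x hx => by
      have h1 : ‖(√(d : ℝ))⁻¹ • WithLp.toLp 2 x‖ ^ 2 < 1 / 2 := hx
      rw [hnorm, div_lt_iff₀ hd'] at h1
      show ∑ i, x i ^ 2 ≤ (d : ℝ) / 2
      linarith
    have ht : (-(1 / 2) : ℝ) < 1 / 2 := by norm_num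
    -- Chernoff at `t = -1/2`: the bound is `exp (d/4 - d * log 2 / 2)`, and `log 2 / 2 - 1/4 >
    -- 1/16`.
    refine (measureReal_mono hsub).trans ((measure_le_le_exp_mul_mgf ((d : ℝ) / 2)
      (by norm_num : (-(1 / 2) : ℝ) ≤ 0) (mgf_sum_sq_gaussianReal ht).1).trans ?_)
    rw [(mgf_sum_sq_gaussianReal ht).2]
    norm_num
    rw [hsqrt, ← Real.exp_nat_mul, ← Real.exp_neg, ← Real.exp_add, Real.exp_le_exp]
    nlinarith
  · rw [isoGaussian_eq_map, map_measureReal_apply hmeas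
      (measurableSet_lt measurable_const (by fun_prop))]
    have hsub : (fun x : Fin d → ℝ => (√(d : ℝ))⁻¹ • WithLp.toLp 2 x) ⁻¹' {x | 2 < ‖x‖ ^ 2} ⊆
        {x | 2 * (d : ℝ) ≤ ∑ i, x i ^ 2} := fun x hx => by
      have h1 : 2 < ‖(√(d : ℝ))⁻¹ • WithLp.toLp 2 x‖ ^ 2 := hx
      rw [hnorm, lt_div_iff₀ hd'] at h1
      exact h1.le
    have ht : (1 / 4 : ℝ) < 1 / 2 := by norm_num
    -- Chernoff at `t = 1/4`: the bound is `exp (-d/2 + d * log 2 / 2)`, and `1/2 - log 2 / 2 >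
    -- 1/16`.
    refine (measureReal_mono hsub).trans ((measure_ge_le_exp_mul_mgf (2 * (d : ℝ))
      (by norm_num : (0 : ℝ) ≤ 1 / 4) (mgf_sum_sq_gaussianReal ht).1).trans ?_)
    rw [(mgf_sum_sq_gaussianReal ht).2]
    have hhalf : (√(1 - 2 * (1 / 4)))⁻¹ = √2 := by
      rw [← Real.sqrt_inv]
      norm_num
    rw [hhalf, hsqrt, ← Real.exp_nat_mul, ← Real.exp_add, Real.exp_le_exp]
    nlinarith

end Concentration

/-! ### The initialization is nearly orthogonal with high probability -/

section Initialization

variable {S : Type*} [Fintype S] {d : ℕ}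

instance (S : Type*) [Fintype S] (d : ℕ) : IsProbabilityMeasure (initLaw S d) := by
  unfold initLaw
  infer_instance

lemma map_cls_initLaw (S : Type*) [Fintype S] (d : ℕ) :
    (initLaw S d).map Prod.snd = isoGaussian d := by
  rw [initLaw, Measure.map_snd_prod, measure_univ, one_smul]

lemma map_tok_initLaw (s : S) : (initLaw S d).map (fun ω => ω.1 s) = isoGaussian d := by
  have h : (fun ω : (S → Emb d) × Emb d => ω.1 s) = Function.eval s ∘ Prod.fst := rfl
  rw [h, ← Measure.map_map (measurable_pi_apply s) measurable_fst, initLaw, Measure.map_fst_prod,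
    measure_univ, one_smul]
  exact (measurePreserving_eval (fun _ : S => isoGaussian d) s).map_eq

lemma indepFun_tok_cls (s : S) :
    IndepFun (fun ω : (S → Emb d) × Emb d => ω.1 s) (fun ω => ω.2) (initLaw S d) :=
  indepFun_prod (X := fun E : S → Emb d => E s) (Y := id) (measurable_pi_apply s) measurable_id

lemma indepFun_tok_tok {s s' : S} (hs : s ≠ s') :
    IndepFun (fun ω : (S → Emb d) × Emb d => ω.1 s) (fun ω => ω.1 s') (initLaw S d) := by
  have h1 := (iIndepFun_pi (X := fun _ : S => (id : Emb d → Emb d))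
    (μ := fun _ : S => isoGaussian d) fun _ => aemeasurable_id).indepFun hs
  have h2 : (initLaw S d).map Prod.fst = Measure.pi fun _ : S => isoGaussian d := by
    rw [initLaw, Measure.map_fst_prod, measure_univ, one_smul]
  have hm : ∀ s : S, Measurable fun E : S → Emb d => id (E s) := fun s => measurable_pi_apply s
  rw [← h2, indepFun_iff_map_prod_eq_prod_map_map (hm s).aemeasurable (hm s').aemeasurable] at h1
  rw [indepFun_iff_map_prod_eq_prod_map_map (by fun_prop) (by fun_prop)]
  rw [Measure.map_map (by fun_prop) (by fun_prop), Measure.map_map (by fun_prop) (by fun_prop),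
    Measure.map_map (by fun_prop) (by fun_prop)] at h1
  exact h1

lemma measurableSet_nearOrthogonal (τ : ℝ) (v : Emb d) :
    MeasurableSet {ω : (S → Emb d) × Emb d | NearOrthogonal τ v ω.1 ω.2} := by
  have heq : {ω : (S → Emb d) × Emb d | NearOrthogonal τ v ω.1 ω.2} =
      {ω | (∀ s, |⟪ω.1 s, v⟫| ≤ τ) ∧ |⟪ω.2, v⟫| ≤ τ ∧ (∀ s, |⟪ω.1 s, ω.2⟫| ≤ τ) ∧
        (∀ s s', s ≠ s' → |⟪ω.1 s, ω.1 s'⟫| ≤ τ) ∧ (∀ s, 1 / 2 ≤ ‖ω.1 s‖ ^ 2) ∧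
        (∀ s, ‖ω.1 s‖ ^ 2 ≤ 2) ∧ ‖ω.2‖ ^ 2 ≤ 2} := by
    ext ω
    exact ⟨fun ⟨h1, h2, h3, h4, h5, h6, h7⟩ => ⟨h1, h2, h3, h4, h5, h6, h7⟩,
      fun ⟨h1, h2, h3, h4, h5, h6, h7⟩ => ⟨h1, h2, h3, h4, h5, h6, h7⟩⟩
  rw [heq]
  refine IsClosed.measurableSet ?_
  simp only [Set.ofPred_and, Set.ofPred_forall]
  refine (isClosed_iInter fun s => isClosed_le (by fun_prop) continuous_const).inter
    ((isClosed_le (by fun_prop) continuous_const).inter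
    ((isClosed_iInter fun s => isClosed_le (by fun_prop) continuous_const).inter
    ((isClosed_iInter fun s => isClosed_iInter fun s' => isClosed_iInter fun _ =>
      isClosed_le (by fun_prop) continuous_const).inter
    ((isClosed_iInter fun s => isClosed_le continuous_const (by fun_prop)).inter
    ((isClosed_iInter fun s => isClosed_le (by fun_prop) continuous_const).inter
    (isClosed_le (by fun_prop) continuous_const))))))

lemma initLaw_compl_nearOrthogonal_le (hd : 0 < d) {τ : ℝ} (hτ : 0 ≤ τ) {v : Emb d}
    (hv : ‖v‖ = 1) {r : ℝ} (hr1 : 2 * Real.exp (-(τ ^ 2 * d / 4)) ≤ r)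
    (hr2 : 2 * Real.exp (-((d : ℝ) / 16)) ≤ r) :
    (initLaw S d).real {ω | NearOrthogonal τ v ω.1 ω.2}ᶜ ≤
      (2 + 3 * Fintype.card S + (Fintype.card S : ℝ) ^ 2) * r := by
  have hr : 0 ≤ r := le_trans (by positivity) hr1
  have htok : ∀ s : S, Measurable fun ω : (S → Emb d) × Emb d => ω.1 s := fun s => by fun_prop
  have hcls : Measurable fun ω : (S → Emb d) × Emb d => ω.2 := measurable_snd
  set ρ := initLaw S d with hρ
  have hdir : (isoGaussian d).real {x | τ < |⟪x, v⟫|} ≤ r :=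
    (isoGaussian_abs_inner_le hd (by rw [hv]; norm_num) hτ).trans hr1
  have hdirm : MeasurableSet {x : Emb d | τ < |⟪x, v⟫|} :=
    measurableSet_lt measurable_const (by fun_prop)
  have hnrm : (isoGaussian d).real ({x | ‖x‖ ^ 2 < 1 / 2} ∪ {x | 2 < ‖x‖ ^ 2}) ≤ r := by
    obtain ⟨h1, h2⟩ := isoGaussian_norm_sq_concentration hd
    exact (measureReal_union_le _ _).trans (by linarith)
  have hnrmm : MeasurableSet ({x : Emb d | ‖x‖ ^ 2 < 1 / 2} ∪ {x | 2 < ‖x‖ ^ 2}) :=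
    (measurableSet_lt (by fun_prop) measurable_const).union
      (measurableSet_lt measurable_const (by fun_prop))
  set N : Set (Emb d) := {x | ‖x‖ ^ 2 < 1 / 2} ∪ {x | 2 < ‖x‖ ^ 2} with hN
  set D : Set (Emb d) := {x | τ < |⟪x, v⟫|} with hD
  -- With `s ≠ s'` inside the event, the union runs over all ordered pairs and the diagonal is
  -- empty; this is the source of the `|S| ^ 2` term.
  set Q : S → S → Set ((S → Emb d) × Emb d) :=
    fun s s' => {ω | s ≠ s' ∧ τ < |⟪ω.1 s, ω.1 s'⟫| ∧ ‖ω.1 s'‖ ^ 2 ≤ 2} with hQ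
  set R : S → Set ((S → Emb d) × Emb d) :=
    fun s => {ω | τ < |⟪ω.1 s, ω.2⟫| ∧ ‖ω.2‖ ^ 2 ≤ 2} with hR
  have hsub : {ω : (S → Emb d) × Emb d | NearOrthogonal τ v ω.1 ω.2}ᶜ ⊆
      (((fun ω => ω.2) ⁻¹' N) ∪ ((fun ω => ω.2) ⁻¹' D)) ∪
        ⋃ s, ((((fun ω => ω.1 s) ⁻¹' N) ∪ ((fun ω => ω.1 s) ⁻¹' D)) ∪ (R s ∪ ⋃ s', Q s s')) := by
    intro ω hω
    by_contra hcon
    simp only [hN, hD, hQ, hR, Set.mem_union, Set.mem_preimage, Set.mem_iUnion, not_or, not_exists,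
      Set.mem_ofPred_eq, not_lt, not_and] at hcon
    obtain ⟨⟨hp1, hp2⟩, hs⟩ := hcon
    exact hω ⟨fun s => (hs s).1.2, hp2,
      fun s => not_lt.1 fun h => absurd hp1.2 (not_le.2 (lt_of_not_ge ((hs s).2.1 h))),
      fun s s' hne => not_lt.1 fun h => absurd (hs s').1.1.2
        (not_le.2 (lt_of_not_ge ((hs s).2.2 s' hne h))),
      fun s => (hs s).1.1.1, fun s => (hs s).1.1.2, hp1.2⟩
  have hclsle : ∀ {B : Set (Emb d)}, MeasurableSet B → (isoGaussian d).real B ≤ r →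
      ρ.real ((fun ω => ω.2) ⁻¹' B) ≤ r := fun hBm hB => by
    rw [← map_measureReal_apply hcls hBm, hρ]
    exact (congrArg (fun μ => Measure.real μ _) (map_cls_initLaw S d)).trans_le hB
  have htokle : ∀ (s : S) {B : Set (Emb d)}, MeasurableSet B → (isoGaussian d).real B ≤ r →
      ρ.real ((fun ω => ω.1 s) ⁻¹' B) ≤ r := fun s _ hBm hB => by
    rw [← map_measureReal_apply (htok s) hBm, hρ, map_tok_initLaw]
    exact hB
  have hRle : ∀ s, ρ.real (R s) ≤ r := fun s =>
    (measureReal_abs_inner_le hd (htok s) hcls (indepFun_tok_cls s) (map_tok_initLaw s) hτ).trans hr1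
  have hQle : ∀ s s', ρ.real (Q s s') ≤ r := fun s s' => by
    by_cases hne : s = s'
    · have : Q s s' = ∅ := by
        ext ω
        simp [hQ, hne]
      rw [this, measureReal_empty]
      exact hr
    · refine (measureReal_mono fun ω hω => hω.2).trans ((measureReal_abs_inner_le hd (htok s)
        (htok s') (indepFun_tok_tok hne) (map_tok_initLaw s) hτ).trans hr1)
  have hcard : ∀ {f : S → Set ((S → Emb d) × Emb d)} {b : ℝ}, (∀ s, ρ.real (f s) ≤ b) →
      ρ.real (⋃ s, f s) ≤ Fintype.card S * b := fun {f b} hf => by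
    refine (measureReal_iUnion_fintype_le _).trans ((Finset.sum_le_sum fun s _ => hf s).trans ?_)
    rw [Finset.sum_const, Finset.card_univ, nsmul_eq_mul]
  refine (measureReal_mono hsub).trans ((measureReal_union_le _ _).trans ?_)
  have h1 := (measureReal_union_le _ _).trans
    (add_le_add (hclsle hnrmm hnrm) (hclsle hdirm hdir))
  have h2 := hcard fun s => (measureReal_union_le _ _).trans (add_le_add
    ((measureReal_union_le _ _).trans (add_le_add (htokle s hnrmm hnrm) (htokle s hdirm hdir)))
    ((measureReal_union_le _ _).trans (add_le_add (hRle s) (hcard fun s' => hQle s s'))))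
  refine (add_le_add h1 h2).trans (le_of_eq ?_)
  ring

end Initialization

end ClsAttention

/-! ### Choice of the orthogonality scale and conclusion -/

theorem theorem1 {S : Type*} [Fintype S] [DecidableEq S] {n T d : ℕ}
    (X : Fin n → Fin T → S) (y : Fin n → ℝ)
    (hy : ∀ k, y k = 1 ∨ y k = -1)
    (hvocab : ∀ s : S, ∃ k, Appears (X k) s)
    (hdata : SingleCompleteToken X y)
    (hirr : ∃ s : S, Irrelevant X y s)
    (v : Emb d) (hv : ‖v‖ = 1)
    (δ : ℝ) (hδ : 0 < δ)
    (η₀ : ℝ) (hη : 4 * (n : ℝ) ^ 2 * (T : ℝ) ^ 2 ≤ η₀)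
    (hd1 : (256 : ℝ) ≤ d)
    (hd2 : (2 * Real.log ((Fintype.card S : ℝ) ^ 2 / δ)) ^ 2 ≤ d)
    (hd3 : (88 * η₀ ^ 2 + 111 * η₀ + 2) ^ 8 ≤ d)
    (hd4 : (Fintype.card S : ℝ) + 3 ≤ d) :
    ∃ A : Set ((S → Emb d) × Emb d), MeasurableSet A ∧
      ENNReal.ofReal (1 - δ) ≤ initLaw S d A ∧
      ∀ ω ∈ A, ∀ p : ℝ → Emb d,
        IsGradientFlow X y v (stepTok X y v η₀ ω.1 ω.2) (stepCls X y v η₀ ω.1 ω.2) p →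
        Tendsto (fun t => ‖p t‖) atTop atTop ∧
        ∀ pinf : Emb d, Tendsto (fun t => (‖p t‖)⁻¹ • p t) atTop (𝓝 pinf) →
          completeTokens X y ⊆ ⋃ k, selected (stepTok X y v η₀ ω.1 ω.2) (X k) pinf ∧
          maxMarginDirections (stepTok X y v η₀ ω.1 ω.2) X pinf = {pinf} := by
  have hparam : 0 < n ∧ 0 < T := by
    obtain ⟨s, _⟩ := hirr
    obtain ⟨k, i, _⟩ := hvocab s
    exact ⟨k.pos, i.pos⟩
  obtain ⟨hn, hT⟩ := hparam
  have hn' : (1 : ℝ) ≤ n := by exact_mod_cast hn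
  have hT' : (1 : ℝ) ≤ T := by exact_mod_cast hT
  have hη1 : 1 ≤ η₀ := by
    have : 1 ≤ (n : ℝ) ^ 2 * (T : ℝ) ^ 2 := one_le_mul_of_one_le_of_one_le
      (one_le_pow₀ hn') (one_le_pow₀ hT')
    linarith
  have hcard : (1 : ℝ) ≤ Fintype.card S := by
    obtain ⟨s, _⟩ := hirr
    exact_mod_cast Fintype.card_pos_iff.2 ⟨s⟩
  have hd0 : (0 : ℝ) < d := by linarith
  have hd : 0 < d := by exact_mod_cast hd0
  set B := 88 * η₀ ^ 2 + 111 * η₀ + 2 with hB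
  have hB0 : 88 * η₀ ^ 2 ≤ B := by linarith
  have hB1 : 88 ≤ B := by nlinarith
  set u := √(d : ℝ) with hu
  have hud : u ^ 2 = d := Real.sq_sqrt hd0.le
  have huB : B ^ 4 ≤ u := Real.le_sqrt_of_sq_le (by rw [← pow_mul]; exact hd3)
  have hu32 : 32 ≤ u := by
    have : (88 : ℝ) ^ 4 ≤ B ^ 4 := by gcongr
    linarith
  have hu0 : 0 < u := by linarith
  have hruB : B ^ 2 ≤ √u := Real.le_sqrt_of_sq_le (by rw [← pow_mul]; exact huB)
  have hru0 : 0 < √u := Real.sqrt_pos.2 hu0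
  -- The scale `3 d^{-1/4}` balances two demands: `τ ^ 2 * d / 4 = 9/4 * √d` gives a tail below `exp
  -- (-2 √d)`, while `√u ≥ B ^ 2 ≥ (88 * η₀ ^ 2) ^ 2` makes `224 * η₀ ^ 3 * τ ≤ 1`.
  set τ := 3 / √u with hτ
  have hτ0 : 0 ≤ τ := by positivity
  have hτd : τ ^ 2 * d / 4 = 9 / 4 * u := by
    rw [hτ, div_pow, Real.sq_sqrt hu0.le, ← hud]
    field_simp
    norm_num
  have hsmall : 224 * η₀ ^ 3 * τ ≤ 1 := by
    rw [hτ, mul_div_assoc', div_le_one hru0]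
    have h1 : (88 * η₀ ^ 2) ^ 2 ≤ B ^ 2 := by gcongr
    have h2 : η₀ ^ 3 ≤ η₀ ^ 4 := pow_le_pow_right₀ hη1 (by norm_num)
    have h3 : 0 ≤ η₀ ^ 3 := by positivity
    nlinarith
  have hcompl := initLaw_compl_nearOrthogonal_le (S := S) hd hτ0 hv
    (r := 2 * Real.exp (-(2 * u)))
    (by
      rw [hτd]
      refine mul_le_mul_of_nonneg_left (Real.exp_le_exp.2 ?_) two_pos.le
      linarith)
    (by
      rw [← hud]
      refine mul_le_mul_of_nonneg_left (Real.exp_le_exp.2 ?_) two_pos.le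
      nlinarith)
  have hlog : (Fintype.card S : ℝ) ^ 2 ≤ δ * Real.exp (u / 2) := by
    have h1 : 2 * Real.log ((Fintype.card S : ℝ) ^ 2 / δ) ≤ u :=
      (le_abs_self _).trans (Real.abs_le_sqrt hd2)
    have h2 := (Real.log_le_iff_le_exp (by positivity)).1
      (by linarith : Real.log ((Fintype.card S : ℝ) ^ 2 / δ) ≤ u / 2)
    rwa [div_le_iff₀' hδ] at h2
  -- The number of events is at most `6 |S| ^ 2 ≤ 6 δ exp (u / 2)`, so the total failure probability
  -- is at most `12 δ exp (-3u/2)`, which is below `δ` because `u ≥ 32`.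
  have hδ' : (2 + 3 * Fintype.card S + (Fintype.card S : ℝ) ^ 2) * (2 * Real.exp (-(2 * u))) ≤
      δ := by
    have h1 : 2 + 3 * Fintype.card S + (Fintype.card S : ℝ) ^ 2 ≤
        6 * (δ * Real.exp (u / 2)) := by nlinarith
    refine (mul_le_mul_of_nonneg_right h1 (by positivity)).trans ?_
    have h2 : 6 * (δ * Real.exp (u / 2)) * (2 * Real.exp (-(2 * u))) =
        δ * (12 * Real.exp (-(3 / 2 * u))) := by
      have : Real.exp (-(3 / 2 * u)) = Real.exp (u / 2) * Real.exp (-(2 * u)) := by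
        rw [← Real.exp_add]
        ring_nf
      rw [this]
      ring
    rw [h2]
    refine mul_le_of_le_one_right hδ.le ?_
    rw [Real.exp_neg, ← div_eq_mul_inv, div_le_one (Real.exp_pos _)]
    linarith [Real.add_one_le_exp (3 / 2 * u)]
  refine ⟨{ω | NearOrthogonal τ v ω.1 ω.2}, measurableSet_nearOrthogonal τ v, ?_,
    fun ω hω p hp => NearOrthogonal.flow_limit hω hv hy hvocab hdata hirr hη hsmall hp⟩
  rw [← ENNReal.ofReal_toReal (measure_ne_top (initLaw S d) _)]
  refine ENNReal.ofReal_le_ofReal ?_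
  have h1 := probReal_compl_eq_one_sub (μ := initLaw S d) (measurableSet_nearOrthogonal (S := S) τ v)
  rw [measureReal_def (initLaw S d) {ω | NearOrthogonal τ v ω.1 ω.2}] at h1
  linarith [hcompl.trans hδ']
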